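/- Let $V$ and $H$ be real Hilbert spaces forming a Gelfand triple $V \hookrightarrow H \cong H^* \hookrightarrow V^*$, the embedding of $V$ into $H$ being compact and dense. Let $a\colon V\times V\to\mathbb{R}$ be a continuous bilinear form for which there are $\alpha_0>0$ and $\omega_0\ge 0$ with $a(v,v)+\omega_0\|v\|_H^2\ge\alpha_0\|v\|_V^2$ for all $v\in V$, and let $A\colon V\to V^*$ be given by $\langle Ay,v\rangle=a(y,v)$. Let $(\omega,\varrho)$ be a measure space, $B\colon L^2(\omega,\varrho)\to V^*$ linear and continuous, $y_0,y_d\in H$, $\delta_0>0$, and $u_a,u_b\in L^\infty(\omega,\varrho)$ with $u_a<u_b$ a.e. Put $U_{ad}=\{u\in L^2(\omega,\varrho): u_a\le u\le u_b \text{ a.e.}\}$ and assume that $U_{ad}$ is bounded in $L^2(\omega,\varrho)$ (automatic if $\varrho(\omega)<\infty$). For $T\ge 0$ let $U_{ad}(0,T)=\{u\in L^2((0,T);L^2(\omega,\varrho)): u(t)\in U_{ad}\text{ for a.e. }t\in(0,T)\}$, and for $u\in U_{ad}(0,T)$ let $y[u]\in H^1((0,T);V^*)\cap L^2((0,T);V)\hookrightarrow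 C([0,T];H)$ be the solution of $\partial_t y+Ay=Bu$ in $(0,T)$, $y(0)=y_0$ (so $y[u](0)=y_0$ if $T=0$). Define $$T(\delta)=\inf\{T>0:\ \|y[u](T)-y_d\|_H\le\delta_0+\delta\ \text{for some}\ u\in U_{ad}(0,T)\}\in[0,\infty]\qquad(\delta\ge 0),$$ $$\delta(T)=\inf\{\|y[u](T)-y_d\|_H-\delta_0:\ u\in U_{ad}(0,T)\}\qquad(T\ge 0),$$ with $\inf\emptyset=\infty$ in the first line, so that $\delta(0)=\delta^\bullet:=\|y_0-y_d\|_H-\delta_0$. Assume that $\|y[u](T)-y_d\|_H\le\delta_0$ for some $T>0$ and $u\in U_{ad}(0,T)$, that $\|y_0-y_d\|_H>\delta_0$, and that $T(\delta^\bullet)=0$. If $T(\cdot)$ is left-continuous on $(0,\infty)$, then $\delta(\cdot)$ is nonnegative, continuous and strictly decreasing on $[0,T(0)]$. Moreover $T(\delta(T'))=T'$ for all $T'\in[0,T(0)]$, and, for all $\delta'\in[0,\delta^\bullet]$, $T(\delta')<\infty$ and $\delta(T(\delta'))=\delta'$. Hence the two value functions are mutually inverse. -/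

import Mathlib

open MeasureTheory
open scoped ENNReal

/-- The data of the control problem: a Gelfand triple `V ↪ H ≅ H* ↪ V*` of real Hilbert spaces
with compact dense embedding `ι : V → H`, a continuous bilinear form `a` on `V` satisfying
Gårding's inequality, a control operator `B : L²(ω, ϱ) → V*`, control bounds `ua < ub` in
`L^∞(ω, ϱ)`, an initial state, a desired state and a radius `δ₀ > 0`.
Here `V* = StrongDual ℝ V`. -/
structure ParabolicControlProblem (V H : Type*)
    [NormedAddCommGroup V] [InnerProductSpace ℝ V] [CompleteSpace V]
    [NormedAddCommGroup H] [InnerProductSpace ℝ H] [CompleteSpace H]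
    {Ω : Type*} [MeasurableSpace Ω] (ϱ : Measure Ω) where
  /-- the embedding of `V` into `H` -/
  ι : V →L[ℝ] H
  ι_injective : Function.Injective ι
  ι_compact : IsCompactOperator ι
  ι_dense : DenseRange ι
  /-- the bilinear form `a(v, w)`; curried, `v ↦ a v` is the operator `A : V → V*` with
  `⟨A v, w⟩ = a(v, w)` -/
  a : V →L[ℝ] V →L[ℝ] ℝ
  garding : ∃ α₀ : ℝ, 0 < α₀ ∧ ∃ ω₀ : ℝ, 0 ≤ ω₀ ∧
    ∀ v : V, α₀ * ‖v‖ ^ 2 ≤ a v v + ω₀ * ‖ι v‖ ^ 2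
  /-- the control operator -/
  B : Lp ℝ 2 ϱ →L[ℝ] StrongDual ℝ V
  /-- the lower control bound -/
  ua : Lp ℝ ∞ ϱ
  /-- the upper control bound -/
  ub : Lp ℝ ∞ ϱ
  ua_lt_ub : ∀ᵐ x ∂ϱ, ua x < ub x
  /-- the initial state -/
  y₀ : H
  /-- the desired state -/
  yd : H
  /-- the radius of the target ball -/
  δ₀ : ℝ
  δ₀_pos : 0 < δ₀

namespace ParabolicControlProblem

variable {V H : Type*}
  [NormedAddCommGroup V] [InnerProductSpace ℝ V] [CompleteSpace V]
  [NormedAddCommGroup H] [InnerProductSpace ℝ H] [CompleteSpace H]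
  {Ω : Type*} [MeasurableSpace Ω] {ϱ : Measure Ω}

/-- The embedding `H ≅ H* ↪ V*`, i.e. `⟨h, v⟩ = (h, ι v)_H`. -/
noncomputable def toDual (P : ParabolicControlProblem V H ϱ) (h : H) : StrongDual ℝ V :=
  (innerSL ℝ h).comp P.ι

/-- `U_ad = {u ∈ L²(ω) : ua ≤ u ≤ ub a.e.}`. -/
def Uad (P : ParabolicControlProblem V H ϱ) : Set (Lp ℝ 2 ϱ) :=
  {u | ∀ᵐ x ∂ϱ, P.ua x ≤ u x ∧ u x ≤ P.ub x}

/-- `u ∈ U_ad(0,T)`: `u ∈ L²((0,T); L²(ω))` and `u(t) ∈ U_ad` for a.e. `t ∈ (0,T)`. -/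
def IsAdmissible (P : ParabolicControlProblem V H ϱ) (T : ℝ) (u : ℝ → Lp ℝ 2 ϱ) : Prop :=
  MemLp u 2 (volume.restrict (Set.Ioo 0 T)) ∧
    ∀ᵐ t ∂volume.restrict (Set.Ioo 0 T), u t ∈ P.Uad

/-- `y` is (the representative in `C([0,T]; H)` of) an element of
`W(0,T) = H¹((0,T); V*) ∩ L²((0,T); V)`. As an `L²((0,T); V)`-function it is `w`, and its
derivative in `L²((0,T); V*)` is `dy`, in the sense that `y` is in `V*` the primitive of `dy`. -/
structure IsW (P : ParabolicControlProblem V H ϱ) (T : ℝ)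
    (y : ℝ → H) (w : ℝ → V) (dy : ℝ → StrongDual ℝ V) : Prop where
  continuousOn : ContinuousOn y (Set.Icc 0 T)
  memLp_w : MemLp w 2 (volume.restrict (Set.Ioo 0 T))
  eq_w : ∀ᵐ t ∂volume.restrict (Set.Ioo 0 T), y t = P.ι (w t)
  memLp_dy : MemLp dy 2 (volume.restrict (Set.Ioo 0 T))
  primitive : ∀ t ∈ Set.Icc 0 T, P.toDual (y t) = P.toDual (y 0) + ∫ s in (0 : ℝ)..t, dy s

/-- `y = y[u]` on `[0,T]`: `y ∈ W(0,T)` solves `∂ₜ y + A y = B u` in `(0,T)`, `y(0) = y₀`. -/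
def IsState (P : ParabolicControlProblem V H ϱ) (T : ℝ) (u : ℝ → Lp ℝ 2 ϱ) (y : ℝ → H) : Prop :=
  y 0 = P.y₀ ∧ ∃ (w : ℝ → V) (dy : ℝ → StrongDual ℝ V), P.IsW T y w dy ∧
    ∀ᵐ t ∂volume.restrict (Set.Ioo 0 T), dy t + P.a (w t) = P.B (u t)

/-- The terminal distances `‖y[u](T) - yd‖` that are attained by admissible controls. -/
def distances (P : ParabolicControlProblem V H ϱ) (T : ℝ) : Set ℝ :=
  {d | ∃ u y, P.IsAdmissible T u ∧ P.IsState T u y ∧ d = ‖y T - P.yd‖}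

/-- The minimal time value function with values in `[0,∞]`:
`T(δ) = inf {T > 0 : ‖y[u](T) - yd‖ ≤ δ₀ + δ for some u ∈ U_ad(0,T)}`, with `inf ∅ = ∞`. -/
noncomputable def minTime (P : ParabolicControlProblem V H ϱ) (δ : ℝ) : ℝ≥0∞ :=
  sInf {s | ∃ T : ℝ, 0 < T ∧ (∃ d ∈ P.distances T, d ≤ P.δ₀ + δ) ∧ s = ENNReal.ofReal T}

/-- The minimal distance value function `δ(T) = inf {‖y[u](T) - yd‖ - δ₀ : u ∈ U_ad(0,T)}`.
For `T = 0` the only state is `y₀`, so that `δ(0) = ‖y₀ - yd‖ - δ₀`. -/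
noncomputable def minDist (P : ParabolicControlProblem V H ϱ) (T : ℝ) : ℝ :=
  sInf {r | ∃ d ∈ P.distances T, r = d - P.δ₀}

/-- `δ• = ‖y₀ - yd‖ - δ₀`. -/
noncomputable def deltaBullet (P : ParabolicControlProblem V H ϱ) : ℝ :=
  ‖P.y₀ - P.yd‖ - P.δ₀

/-- The set of real numbers in `[0, T(0)]`. -/
def timeInterval (P : ParabolicControlProblem V H ϱ) : Set ℝ :=
  {T | 0 ≤ T ∧ ENNReal.ofReal T ≤ P.minTime 0}

end ParabolicControlProblem

/-!
The whole analytic content is one closedness property, `exists_distance_le_of_forall`: if for times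
`T` arbitrarily close to `S ≥ 0` the distance to `yd` can be made at most `r + ε`, then at time `S`
a distance at most `r` is attained. It gives that the infimum in `minTime` is attained
(`exists_distance_minTime_le`) and that `minTime` is right-continuous (`minTime_le_of_forall_add`).
Conversely, a state whose distance at time `minTime δ` were smaller than `δ₀ + δ` would by
continuity already be in the larger ball a little earlier. Hence
`minDist (minTime δ) = δ` for `0 ≤ δ ≤ δ•` (`minDist_minTime`). Left- and right-continuity of the
antitone function `minTime` on `[0, δ•]`, together with `minTime δ• = 0`, make it attain every value
in `[0, T(0)]` (`exists_minTime_eq`), so `minDist` is its inverse. A strictly antitone function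
mapping onto an interval is continuous.

For the closedness property with `S > 0`, states on `(0, T)` are dilated in time to `(0, S)`. The
dilated functions solve the equation up to a residual of size `|T / S - 1|` in `L²((0, S); V*)`, by
the a priori bound `exists_eLpNorm_le` (Gårding's inequality and Grönwall's lemma). The approximate
solutions with residual and excess distance at most `ε` form bounded convex sets in a Hilbert space
that shrink with `ε`; almost minimal-norm elements of nested bounded convex sets form a Cauchy
sequence (`exists_cauchySeq_of_antitone_convex`). Their strong limit is an exact state, because the
energy inequality turns convergence of `w` and `∂ₜ y` in `L²` into uniform convergence of `y` in
`H`. Neither an existence theory for the parabolic equation nor weak compactness is required. For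
`S = 0`, states at small times converge weakly to `y₀`.

The energy inequality `‖y(t)‖² ≤ ‖y(0)‖² + 2 ∫₀ᵗ ⟨∂ₜ y, y⟩` (`IsW.energy_le`) is obtained by
integrating `‖y(r)‖² - ‖y(r - h)‖² ≤ 2 (y(r) - y(r - h), y(r))_H` over `r`, dividing by `h` and
letting `h → 0`; the right-hand side converges by continuity of translations in `L²`.
-/

open Filter Topology

namespace ParabolicControlProblem

/-! ### Translations of square integrable functions -/

/-- By Riesz representation the integral is the `L²` inner product with a translate, and
translations act continuously on `L²`. -/
theorem continuous_correlation {V : Type*} [NormedAddCommGroup V] [InnerProductSpace ℝ V]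
    [CompleteSpace V] {G : ℝ → StrongDual ℝ V} {W : ℝ → V}
    (hG : MemLp G 2 volume) (hW : MemLp W 2 volume) :
    Continuous fun s : ℝ ↦ ∫ r, G (r - s) (W r) := by
  let R := (InnerProductSpace.toDual ℝ V).symm
  have hRG : MemLp (fun r ↦ R (G r)) 2 volume :=
    hG.of_le (R.continuous.comp_aestronglyMeasurable hG.1) (.of_forall fun r ↦ by simp)
  let f : Lp V 2 (volume : Measure ℝ) := hRG.toLp _
  let g : Lp V 2 (volume : Measure ℝ) := hW.toLp _
  have hcont : Continuous fun s : ℝ ↦ inner ℝ (DomAddAct.mk (-s) +ᵥ f) g := by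
    have : Fact ((2 : ℝ≥0∞) ≠ ∞) := ⟨by simp⟩
    have h1 : Continuous fun s : ℝ ↦ (DomAddAct.mk (-s) : ℝᵈᵃᵃ) :=
      DomAddAct.continuous_mk.comp continuous_neg
    exact (h1.vadd continuous_const).inner continuous_const
  refine hcont.congr fun s ↦ ?_
  rw [L2.inner_def]
  refine integral_congr_ae ?_
  have hf : ∀ᵐ r : ℝ, f (-s + r) = R (G (-s + r)) :=
    (measurePreserving_add_left (volume : Measure ℝ) (-s)).quasiMeasurePreserving.ae
      hRG.coeFn_toLp
  filter_upwards [DomAddAct.vadd_Lp_ae_eq (DomAddAct.mk (-s)) f, hf, hW.coeFn_toLp]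
    with r h1 h2 h3
  rw [h1, h3]
  simp only [Equiv.symm_apply_apply, vadd_eq_add]
  rw [h2, InnerProductSpace.toDual_symm_apply, neg_add_eq_sub]

/-- Fubini: pairing `W` with the integrals of `G` over windows of length `h` is the same as
integrating the correlation of `G` and `W` over the shifts `s ∈ (0, h)`. -/
theorem integral_average_pairing {V : Type*} [NormedAddCommGroup V] [InnerProductSpace ℝ V]
    {G : ℝ → StrongDual ℝ V} {W : ℝ → V}
    (hG : MemLp G 2 volume) (hW : MemLp W 2 volume) {h : ℝ} (hh : 0 ≤ h) :
    Integrable (fun r ↦ (∫ σ in (r - h)..r, G σ) (W r)) ∧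
    ∫ r, (∫ σ in (r - h)..r, G σ) (W r) = ∫ s in (0 : ℝ)..h, ∫ r, G (r - s) (W r) := by
  have hint : ∀ a b, IntervalIntegrable G volume a b := fun a b ↦
    ((hG.locallyIntegrable (by norm_num)).integrableOn_isCompact isCompact_uIcc).intervalIntegrable
  have key : Integrable (Function.uncurry fun r s : ℝ ↦ G (r - s) (W r))
      (volume.prod (volume.restrict (Set.Ioc 0 h))) := by
    have hG2 : Integrable (fun r ↦ ‖G r‖ ^ 2) := hG.integrable_norm_pow (by norm_num)
    have hW2 : Integrable (fun r ↦ ‖W r‖ ^ 2) := hW.integrable_norm_pow (by norm_num)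
    have hone : Integrable (fun _ : ℝ ↦ (1 : ℝ)) (volume.restrict (Set.Ioc 0 h)) := by
      simp
    have h1 : Integrable (fun p : ℝ × ℝ ↦ ‖G (p.1 - p.2)‖ ^ 2)
        (volume.prod (volume.restrict (Set.Ioc 0 h))) := by
      simpa using hone.convolution_integrand (ContinuousLinearMap.mul ℝ ℝ) hG2
    have h2 : Integrable (fun p : ℝ × ℝ ↦ ‖W p.1‖ ^ 2)
        (volume.prod (volume.restrict (Set.Ioc 0 h))) := by
      have := hW2.mul_prod hone
      simp only [mul_one] at this
      exact this
    refine (h1.add h2).mono' ?_ (.of_forall fun p ↦ ?_)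
    · have hm1 : AEStronglyMeasurable (fun p : ℝ × ℝ ↦ G (p.1 - p.2))
          (volume.prod (volume.restrict (Set.Ioc 0 h))) :=
        hG.1.comp_quasiMeasurePreserving
          (quasiMeasurePreserving_sub_of_right_invariant volume _)
      exact ContinuousLinearMap.aestronglyMeasurable_comp₂
        (ContinuousLinearMap.id ℝ (StrongDual ℝ V)) hm1 hW.1.comp_fst
    · simp only [Function.uncurry, Pi.add_apply]
      have := (G (p.1 - p.2)).le_opNorm (W p.1)
      nlinarith [sq_nonneg (‖G (p.1 - p.2)‖ - ‖W p.1‖), sq_nonneg (‖G (p.1 - p.2)‖ + ‖W p.1‖)]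
  have hpt : ∀ r, (∫ σ in (r - h)..r, G σ) (W r)
      = ∫ s in Set.Ioc 0 h, G (r - s) (W r) := fun r ↦ by
    have h1 : ∫ s in (0 : ℝ)..h, G (r - s) = ∫ σ in (r - h)..r, G σ := by
      simp
    have h2 : IntervalIntegrable (fun s ↦ G (r - s)) volume 0 h := by
      simpa using (hint (r - 0) (r - h)).comp_sub_left r
    rw [← h1, ContinuousLinearMap.intervalIntegral_apply h2,
      intervalIntegral.integral_of_le hh]
  constructor
  · simp_rw [hpt]
    exact key.integral_prod_left
  · simp_rw [hpt]
    rw [integral_integral_swap key, intervalIntegral.integral_of_le hh]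

/-- Dividing the hypothesis by `h` and letting `h → 0`; the values of `q` to the left of `0`
are frozen at `q 0`. -/
theorem le_add_of_forall_integral_le {q c : ℝ → ℝ} (hqc : Continuous q) (hcc : Continuous c)
    {T : ℝ} (hq0 : ∀ r ≤ 0, q r = q 0)
    (hstep : ∀ h : ℝ, 0 < h →
      (∫ r in (T - h)..T, q r) - ∫ r in (-h)..0, q r ≤ 2 * ∫ s in (0 : ℝ)..h, c s) :
    q T ≤ q 0 + 2 * c 0 := by
  have hqi : ∀ a b, IntervalIntegrable q volume a b := fun a b ↦ hqc.intervalIntegrable a b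
  refine le_of_forall_pos_le_add fun ε hε ↦ ?_
  obtain ⟨d1, hd1, h1⟩ := Metric.continuous_iff.1 hcc 0 (ε / 8) (by positivity)
  obtain ⟨d2, hd2, h2⟩ := Metric.continuous_iff.1 hqc T (ε / 8) (by positivity)
  obtain ⟨h, hpos, hlt⟩ := exists_between (lt_min hd1 hd2)
  have hlt1 : h < d1 := hlt.trans_le (min_le_left _ _)
  have hlt2 : h < d2 := hlt.trans_le (min_le_right _ _)
  have b1 : ∫ s in (0 : ℝ)..h, c s ≤ ∫ _ in (0 : ℝ)..h, (c 0 + ε / 8) :=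
    intervalIntegral.integral_mono_on hpos.le (hcc.intervalIntegrable _ _) (by simp)
      fun s hs ↦ by
        have := h1 s (by rw [Real.dist_eq, sub_zero, abs_of_nonneg hs.1]; linarith [hs.2])
        rw [Real.dist_eq] at this
        linarith [(abs_lt.1 this).2]
  have b2 : ∫ _ in (T - h)..T, (q T - ε / 8) ≤ ∫ s in (T - h)..T, q s :=
    intervalIntegral.integral_mono_on (by linarith) (by simp) (hqi _ _)
      fun s hs ↦ by
        have := h2 s (by rw [Real.dist_eq, abs_lt]; constructor <;> linarith [hs.1, hs.2])
        rw [Real.dist_eq] at this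
        linarith [(abs_lt.1 this).1]
  have b3 : ∫ s in (-h)..0, q s = h * q 0 := by
    have : ∫ s in (-h)..0, q s = ∫ _ in (-h)..0, q 0 :=
      intervalIntegral.integral_congr fun s hs ↦ by
        rw [Set.uIcc_of_le (by linarith)] at hs
        exact hq0 s hs.2
    rw [this]; simp
  have b4 := hstep h hpos
  rw [b3] at b4
  simp only [intervalIntegral.integral_const, smul_eq_mul, sub_sub_cancel, sub_zero] at b1 b2
  have b5 : h * q T ≤ h * (q 0 + 2 * c 0 + ε) := by nlinarith
  exact le_of_mul_le_mul_left b5 hpos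

theorem memLp_indicator_of_restrict {α E : Type*} [MeasurableSpace α]
    [NormedAddCommGroup E] {p : ℝ≥0∞} {μ : Measure α} {s : Set α} {f : α → E}
    (hf : MemLp f p (μ.restrict s)) (hs : MeasurableSet s) : MemLp (s.indicator f) p μ :=
  (memLp_indicator_iff_restrict hs).2 hf

variable {V H : Type*}
  [NormedAddCommGroup V] [InnerProductSpace ℝ V] [CompleteSpace V]
  [NormedAddCommGroup H] [InnerProductSpace ℝ H] [CompleteSpace H]
  {Ω : Type*} [MeasurableSpace Ω] {ϱ : Measure Ω}

/-! ### The energy inequality -/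

theorem toDual_apply (P : ParabolicControlProblem V H ϱ) (h : H) (v : V) :
    P.toDual h v = inner ℝ h (P.ι v) := rfl

theorem toDual_sub (P : ParabolicControlProblem V H ϱ) (h k : H) :
    P.toDual (h - k) = P.toDual h - P.toDual k := by
  ext v; simp [toDual_apply, inner_sub_left]

theorem toDual_add (P : ParabolicControlProblem V H ϱ) (h k : H) :
    P.toDual (h + k) = P.toDual h + P.toDual k := by
  ext v; simp [toDual_apply, inner_add_left]

theorem toDual_smul (P : ParabolicControlProblem V H ϱ) (c : ℝ) (h : H) :
    P.toDual (c • h) = c • P.toDual h := by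
  ext v; simp [toDual_apply, inner_smul_left]

theorem continuous_toDual (P : ParabolicControlProblem V H ϱ) : Continuous P.toDual := by
  unfold toDual
  fun_prop

/-- The energy inequality at the final time. Only `‖p‖² - ‖q‖² ≤ 2 (p - q, p)` is used for the
increments, so that `w` has to be known at one of the two times only. -/
theorem energy_le_of_pos (P : ParabolicControlProblem V H ϱ) {T : ℝ} (hT : 0 < T) {y : ℝ → H}
    {w : ℝ → V} {dy : ℝ → StrongDual ℝ V} (hW : P.IsW T y w dy) :
    ‖y T‖ ^ 2 ≤ ‖y 0‖ ^ 2 + 2 * ∫ t in (0 : ℝ)..T, dy t (w t) := by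
  -- the zero extensions of `∂ₜ y` and `w` to the whole line
  set I := Set.Ioo 0 T with hI
  have hIm : MeasurableSet I := measurableSet_Ioo
  set G : ℝ → StrongDual ℝ V := I.indicator dy with hGdef
  set W : ℝ → V := I.indicator w with hWdef
  have hG : MemLp G 2 volume := memLp_indicator_of_restrict hW.memLp_dy hIm
  have hWm : MemLp W 2 volume := memLp_indicator_of_restrict hW.memLp_w hIm
  have hint : ∀ a b, IntervalIntegrable G volume a b := fun a b ↦
    ((hG.locallyIntegrable (by norm_num)).integrableOn_isCompact isCompact_uIcc).intervalIntegrable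
  set c : ℝ → ℝ := fun s ↦ ∫ r, G (r - s) (W r) with hc
  have hcc : Continuous c := continuous_correlation hG hWm
  have hc0 : c 0 = ∫ t in (0 : ℝ)..T, dy t (w t) := by
    rw [intervalIntegral.integral_of_le hT.le, ← integral_Ioc_eq_integral_Ioo.symm,
      ← integral_indicator hIm]
    simp only [hc, sub_zero]
    refine integral_congr_ae (.of_forall fun r ↦ ?_)
    by_cases hr : r ∈ I <;> simp [hGdef, hWdef, hr]
  -- `y` is extended to the whole line by its boundary values
  set z : ℝ → H := Set.IccExtend hT.le ((Set.Icc 0 T).domRestrict y) with hz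
  have hzc : Continuous z := hW.continuousOn.domRestrict.Icc_extend'
  have hzy : ∀ r ∈ Set.Icc 0 T, z r = y r := fun r hr ↦ by
    rw [hz, Set.IccExtend_of_mem _ _ hr]; rfl
  have hz0 : ∀ r ≤ 0, z r = y 0 := fun r hr ↦ by
    rw [hz, Set.IccExtend_of_le_left _ _ hr]; rfl
  -- to the left of `0` this holds since both `z` is constant and `G` vanishes there
  have hprim : ∀ r ≤ T, P.toDual (z r) = P.toDual (y 0) + ∫ s in (0 : ℝ)..r, G s := by
    intro r hr
    rcases le_total r 0 with h0 | h0
    · rw [hz0 r h0, intervalIntegral.integral_symm, intervalIntegral.integral_of_le h0,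
        setIntegral_eq_zero_of_forall_eq_zero]
      · simp
      · intro x hx
        exact Set.indicator_of_notMem (fun h ↦ absurd hx.2 (not_le.2 h.1)) _
    · rw [hzy r ⟨h0, hr⟩, hW.primitive r ⟨h0, hr⟩]
      congr 1
      rw [intervalIntegral.integral_of_le h0, intervalIntegral.integral_of_le h0,
        integral_Ioc_eq_integral_Ioo, integral_Ioc_eq_integral_Ioo]
      refine setIntegral_congr_fun measurableSet_Ioo fun x hx ↦ ?_
      have hxI : x ∈ I := ⟨hx.1, hx.2.trans_le hr⟩
      exact (Set.indicator_of_mem hxI dy).symm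
  set q : ℝ → ℝ := fun r ↦ ‖z r‖ ^ 2 with hq
  have hqc : Continuous q := by fun_prop
  have hqi : ∀ a b, IntervalIntegrable q volume a b := fun a b ↦ hqc.intervalIntegrable a b
  have hstep : ∀ h : ℝ, 0 < h →
      (∫ r in (T - h)..T, q r) - ∫ r in (-h)..0, q r ≤ 2 * ∫ s in (0 : ℝ)..h, c s := by
    intro h hh
    obtain ⟨hi1, hi2⟩ := integral_average_pairing hG hWm hh.le
    have hae : ∀ᵐ r ∂volume.restrict I,
        q r - q (r - h) ≤ 2 * (∫ σ in (r - h)..r, G σ) (W r) := by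
      filter_upwards [hW.eq_w, ae_restrict_mem hIm] with r hr hrI
      have e1 : ∫ σ in (r - h)..r, G σ = P.toDual (z r - z (r - h)) := by
        rw [toDual_sub, hprim r hrI.2.le, hprim (r - h) (by linarith [hrI.2]),
          ← intervalIntegral.integral_add_adjacent_intervals (hint 0 (r - h)) (hint (r - h) r)]
        abel
      have e2 : W r = w r := Set.indicator_of_mem hrI w
      rw [e1, toDual_apply, e2, ← hr, ← hzy r ⟨hrI.1.le, hrI.2.le⟩]
      have h1 := norm_sub_sq_real (z r) (z (r - h))
      have h2 := real_inner_self_eq_norm_sq (z r)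
      simp only [hq, inner_sub_left]
      rw [real_inner_comm] at h1
      nlinarith [sq_nonneg ‖z r - z (r - h)‖]
    have hqs : Continuous fun r ↦ q (r - h) := by fun_prop
    have hLi : IntegrableOn (fun r ↦ q r - q (r - h)) I :=
      ((hqc.sub hqs).integrableOn_Icc (a := 0) (b := T)).mono_set Set.Ioo_subset_Icc_self
    have h1 := integral_mono_ae hLi (hi1.const_mul 2).integrableOn hae
    have h2 : ∫ r in I, (2 * (∫ σ in (r - h)..r, G σ) (W r))
        = ∫ r, 2 * (∫ σ in (r - h)..r, G σ) (W r) :=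
      setIntegral_eq_integral_of_forall_compl_eq_zero fun r hr ↦ by
        simp [hWdef, Set.indicator_of_notMem hr]
    rw [h2, integral_const_mul, hi2] at h1
    rw [hI, ← integral_Ioc_eq_integral_Ioo, ← intervalIntegral.integral_of_le hT.le,
      intervalIntegral.integral_sub (hqi _ _) (hqs.intervalIntegrable _ _),
      intervalIntegral.integral_comp_sub_right q h, zero_sub] at h1
    have a1 := intervalIntegral.integral_add_adjacent_intervals (hqi 0 (T - h)) (hqi (T - h) T)
    have a2 := intervalIntegral.integral_add_adjacent_intervals (hqi (-h) 0) (hqi 0 (T - h))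
    linarith
  rw [← hc0, ← hzy T ⟨hT.le, le_rfl⟩, ← hz0 0 le_rfl]
  refine le_add_of_forall_integral_le hqc hcc (fun r hr ↦ ?_) hstep
  simp only [hq, hz0 r hr, hz0 0 le_rfl]

theorem restrict_Ioo_mono {T t : ℝ} (ht : t ≤ T) :
    (volume : Measure ℝ).restrict (Set.Ioo 0 t) ≤ volume.restrict (Set.Ioo 0 T) :=
  Measure.restrict_mono (Set.Ioo_subset_Ioo_right ht) le_rfl

theorem IsW.restrict {P : ParabolicControlProblem V H ϱ} {T t : ℝ} (ht : t ≤ T) {y : ℝ → H}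
    {w : ℝ → V} {dy : ℝ → StrongDual ℝ V} (h : P.IsW T y w dy) : P.IsW t y w dy where
  continuousOn := h.continuousOn.mono (Set.Icc_subset_Icc_right ht)
  memLp_w := h.memLp_w.mono_measure (restrict_Ioo_mono ht)
  eq_w := ae_mono (restrict_Ioo_mono ht) h.eq_w
  memLp_dy := h.memLp_dy.mono_measure (restrict_Ioo_mono ht)
  primitive s hs := h.primitive s ⟨hs.1, hs.2.trans ht⟩

theorem IsState.restrict {P : ParabolicControlProblem V H ϱ} {T t : ℝ} (ht : t ≤ T)
    {u : ℝ → Lp ℝ 2 ϱ} {y : ℝ → H} (h : P.IsState T u y) : P.IsState t u y := by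
  obtain ⟨h0, w, dy, hW, heq⟩ := h
  exact ⟨h0, w, dy, hW.restrict ht, ae_mono (restrict_Ioo_mono ht) heq⟩

theorem IsAdmissible.restrict {P : ParabolicControlProblem V H ϱ} {T t : ℝ} (ht : t ≤ T)
    {u : ℝ → Lp ℝ 2 ϱ} (h : P.IsAdmissible T u) : P.IsAdmissible t u :=
  ⟨h.1.mono_measure (restrict_Ioo_mono ht), ae_mono (restrict_Ioo_mono ht) h.2⟩

theorem intervalIntegrable_of_memLp {E : Type*} [NormedAddCommGroup E] {f : ℝ → E} {T t : ℝ}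
    (hf : MemLp f 2 (volume.restrict (Set.Ioo 0 T))) (ht : t ∈ Set.Icc 0 T) :
    IntervalIntegrable f volume 0 t := by
  have h := (hf.mono_measure (restrict_Ioo_mono ht.2)).integrable (by norm_num)
  rw [intervalIntegrable_iff_integrableOn_Ioo_of_le ht.1]
  exact h

theorem IsW.linComb {P : ParabolicControlProblem V H ϱ} {T : ℝ} {y₁ y₂ : ℝ → H}
    {w₁ w₂ : ℝ → V} {dy₁ dy₂ : ℝ → StrongDual ℝ V} (h₁ : P.IsW T y₁ w₁ dy₁)
    (h₂ : P.IsW T y₂ w₂ dy₂) (a b : ℝ) :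
    P.IsW T (fun t ↦ a • y₁ t + b • y₂ t) (fun t ↦ a • w₁ t + b • w₂ t)
      (fun t ↦ a • dy₁ t + b • dy₂ t) where
  continuousOn := (h₁.continuousOn.const_smul a).add (h₂.continuousOn.const_smul b)
  memLp_w := (h₁.memLp_w.const_smul a).add (h₂.memLp_w.const_smul b)
  eq_w := by
    filter_upwards [h₁.eq_w, h₂.eq_w] with t e₁ e₂
    simp [e₁, e₂]
  memLp_dy := (h₁.memLp_dy.const_smul a).add (h₂.memLp_dy.const_smul b)
  primitive t ht := by
    have e : ∫ s in (0 : ℝ)..t, (a • dy₁ s + b • dy₂ s)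
        = a • (∫ s in (0 : ℝ)..t, dy₁ s) + b • ∫ s in (0 : ℝ)..t, dy₂ s := by
      rw [← intervalIntegral.integral_smul, ← intervalIntegral.integral_smul]
      exact intervalIntegral.integral_add ((intervalIntegrable_of_memLp h₁.memLp_dy ht).smul a)
        ((intervalIntegrable_of_memLp h₂.memLp_dy ht).smul b)
    rw [e]
    simp only [toDual_add, toDual_smul, h₁.primitive t ht, h₂.primitive t ht, smul_add]
    abel

theorem IsW.congr {P : ParabolicControlProblem V H ϱ} {T : ℝ} {y : ℝ → H} {w w' : ℝ → V}
    {dy dy' : ℝ → StrongDual ℝ V} (h : P.IsW T y w dy)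
    (hw : w =ᵐ[volume.restrict (Set.Ioo 0 T)] w')
    (hdy : dy =ᵐ[volume.restrict (Set.Ioo 0 T)] dy') : P.IsW T y w' dy' where
  continuousOn := h.continuousOn
  memLp_w := h.memLp_w.ae_eq hw
  eq_w := by filter_upwards [h.eq_w, hw] with t h1 h2; rw [h1, h2]
  memLp_dy := h.memLp_dy.ae_eq hdy
  primitive t ht := by
    rw [h.primitive t ht, intervalIntegral.integral_of_le ht.1,
      intervalIntegral.integral_of_le ht.1, integral_Ioc_eq_integral_Ioo,
      integral_Ioc_eq_integral_Ioo]
    congr 1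
    exact integral_congr_ae (ae_mono (restrict_Ioo_mono ht.2) hdy)

theorem IsW.energy_le {P : ParabolicControlProblem V H ϱ} {T : ℝ} {y : ℝ → H}
    {w : ℝ → V} {dy : ℝ → StrongDual ℝ V} (hW : P.IsW T y w dy) {t : ℝ} (ht : t ∈ Set.Icc 0 T) :
    ‖y t‖ ^ 2 ≤ ‖y 0‖ ^ 2 + 2 * ∫ s in (0 : ℝ)..t, dy s (w s) := by
  rcases ht.1.eq_or_lt with rfl | h0
  · simp
  · exact P.energy_le_of_pos h0 (hW.restrict ht.2)

/-! ### A priori bounds -/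

/-- Grönwall's lemma in integral form, as a bound for the primitive of `q`. -/
theorem integral_le_gronwallBound {q : ℝ → ℝ} {T K L : ℝ} (hq : ContinuousOn q (Set.Icc 0 T))
    (h : ∀ t ∈ Set.Icc 0 T, q t ≤ K + L * ∫ s in (0 : ℝ)..t, q s) :
    ∀ t ∈ Set.Icc 0 T, ∫ s in (0 : ℝ)..t, q s ≤ gronwallBound 0 L K t := by
  rcases le_or_gt 0 T with hT | hT
  swap
  · intro t ht; exact absurd (ht.1.trans ht.2) (not_le.2 hT)
  set z : ℝ → ℝ := Set.IccExtend hT ((Set.Icc 0 T).domRestrict q) with hz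
  have hzc : Continuous z := hq.domRestrict.Icc_extend'
  have hzy : ∀ r ∈ Set.Icc 0 T, z r = q r := fun r hr ↦ by
    rw [hz, Set.IccExtend_of_mem _ _ hr]; rfl
  have hint : ∀ t ∈ Set.Icc 0 T, ∫ s in (0 : ℝ)..t, q s = ∫ s in (0 : ℝ)..t, z s := fun t ht ↦
    intervalIntegral.integral_congr fun s hs ↦ by
      rw [Set.uIcc_of_le ht.1] at hs
      exact (hzy s ⟨hs.1, hs.2.trans ht.2⟩).symm
  have hd : ∀ t, HasDerivAt (fun t ↦ ∫ s in (0 : ℝ)..t, z s) (z t) t := fun t ↦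
    hzc.integral_hasStrictDerivAt 0 t |>.hasDerivAt
  intro t ht
  have := le_gronwallBound_of_liminf_deriv_right_le (f := fun t ↦ ∫ s in (0 : ℝ)..t, z s)
    (f' := z) (δ := 0) (K := L) (ε := K) (a := 0) (b := T)
    (fun t _ ↦ (hd t).continuousAt.continuousWithinAt)
    (fun x _ r hr ↦ (hd x).hasDerivWithinAt.liminf_right_slope_le hr) (by simp)
    (fun x hx ↦ by
      have hx' : x ∈ Set.Icc 0 T := ⟨hx.1, hx.2.le⟩
      rw [hzy x hx', ← hint x hx']
      linarith [h x hx']) t ht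
  rw [sub_zero] at this
  rwa [hint t ht]

theorem integrable_pairing {α V : Type*} [MeasurableSpace α] {μ : Measure α}
    [NormedAddCommGroup V] [NormedSpace ℝ V] {g : α → StrongDual ℝ V} {w : α → V}
    (hg : MemLp g 2 μ) (hw : MemLp w 2 μ) : Integrable (fun t ↦ g t (w t)) μ := by
  refine ((hg.integrable_norm_pow (p := 2) (by norm_num)).add
    (hw.integrable_norm_pow (p := 2) (by norm_num))).mono' ?_ (.of_forall fun t ↦ ?_)
  · exact ContinuousLinearMap.aestronglyMeasurable_comp₂
      (ContinuousLinearMap.id ℝ (StrongDual ℝ V)) hg.1 hw.1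
  · simp only [Pi.add_apply]
    have := (g t).le_opNorm (w t)
    nlinarith [sq_nonneg (‖g t‖ - ‖w t‖), sq_nonneg (‖g t‖ + ‖w t‖)]

theorem eLpNorm_two_le_of_integral_sq_le {α E : Type*} [MeasurableSpace α] {μ : Measure α}
    [NormedAddCommGroup E] {f : α → E} (hf : MemLp f 2 μ) {C : ℝ}
    (h : ∫ t, ‖f t‖ ^ 2 ∂μ ≤ C) : eLpNorm f 2 μ ≤ ENNReal.ofReal (Real.sqrt C) := by
  rw [hf.eLpNorm_eq_integral_rpow_norm (by simp) (by simp)]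
  refine ENNReal.ofReal_le_ofReal ?_
  simp only [ENNReal.toReal_ofNat, Real.rpow_two]
  rw [Real.sqrt_eq_rpow, ← one_div]
  exact Real.rpow_le_rpow (integral_nonneg fun _ ↦ by positivity) h (by norm_num)

/-- The bound depends on the final time only through the upper bound `S`. -/
theorem exists_integral_norm_sq_le (P : ParabolicControlProblem V H ϱ)
    (hbounded : Bornology.IsBounded P.Uad) (S : ℝ) :
    ∃ C : ℝ, ∀ T : ℝ, 0 ≤ T → T ≤ S → ∀ u y w dy, P.IsAdmissible T u → y 0 = P.y₀ →
      P.IsW T y w dy →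
      (∀ᵐ t ∂volume.restrict (Set.Ioo 0 T), dy t + P.a (w t) = P.B (u t)) →
      ∫ t in Set.Ioo 0 T, ‖w t‖ ^ 2 ≤ C := by
  obtain ⟨M, hM⟩ := isBounded_iff_forall_norm_le.1 hbounded
  obtain ⟨α, hα, ω, hω, hG⟩ := P.garding
  set K₁ : ℝ := (‖P.B‖ * M) ^ 2 / α with hK₁
  have hK₁0 : 0 ≤ K₁ := by positivity
  refine ⟨(‖P.y₀‖ ^ 2 + K₁ * S + 2 * ω * gronwallBound 0 (2 * ω) (‖P.y₀‖ ^ 2 + K₁ * S) S) / α, ?_⟩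
  intro T hT0 hTS u y w dy hu hy0 hW heq
  have hS : 0 ≤ S := hT0.trans hTS
  have hpt : ∀ᵐ t ∂volume.restrict (Set.Ioo 0 T),
      2 * dy t (w t) ≤ K₁ - α * ‖w t‖ ^ 2 + 2 * ω * ‖y t‖ ^ 2 := by
    filter_upwards [heq, hu.2, hW.eq_w] with t h1 h2 h3
    have e1 : dy t (w t) = P.B (u t) (w t) - P.a (w t) (w t) := by
      rw [← h1]; simp
    have e2 : P.B (u t) (w t) ≤ ‖P.B‖ * M * ‖w t‖ :=
      calc P.B (u t) (w t) ≤ ‖P.B (u t) (w t)‖ := le_abs_self _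
        _ ≤ ‖P.B (u t)‖ * ‖w t‖ := (P.B (u t)).le_opNorm _
        _ ≤ ‖P.B‖ * M * ‖w t‖ := by
          gcongr
          exact (P.B.le_opNorm _).trans (by gcongr; exact hM _ h2)
    have e3 := hG (w t)
    rw [← h3] at e3
    -- Young's inequality, with the weight that leaves half of the coercivity
    have e4 : 2 * (‖P.B‖ * M * ‖w t‖) ≤ K₁ + α * ‖w t‖ ^ 2 := by
      have : 0 ≤ (‖P.B‖ * M - α * ‖w t‖) ^ 2 / α := by positivity
      have e5 : (‖P.B‖ * M - α * ‖w t‖) ^ 2 / α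
          = K₁ - 2 * (‖P.B‖ * M * ‖w t‖) + α * ‖w t‖ ^ 2 := by
        rw [hK₁]; field_simp; ring
      linarith
    linarith
  have hyc : ContinuousOn (fun t ↦ ‖y t‖ ^ 2) (Set.Icc 0 T) := hW.continuousOn.norm.pow 2
  have henergy : ∀ t ∈ Set.Icc 0 T, ‖y t‖ ^ 2 + α * ∫ s in Set.Ioo 0 t, ‖w s‖ ^ 2
      ≤ ‖P.y₀‖ ^ 2 + K₁ * S + 2 * ω * ∫ s in (0 : ℝ)..t, ‖y s‖ ^ 2 := by
    intro t ht
    have hle := restrict_Ioo_mono ht.2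
    have h1 := hW.energy_le ht
    have hi0 := (integrable_pairing hW.memLp_dy hW.memLp_w).mono_measure hle
    have hi1 : Integrable (fun s ↦ ‖w s‖ ^ 2) (volume.restrict (Set.Ioo 0 t)) :=
      (hW.memLp_w.integrable_norm_pow (by norm_num)).mono_measure hle
    have hi2 : Integrable (fun s ↦ ‖y s‖ ^ 2) (volume.restrict (Set.Ioo 0 t)) :=
      Integrable.mono_measure (hyc.integrableOn_Icc.mono_set Set.Ioo_subset_Icc_self) hle
    have hi3 : Integrable (fun _ : ℝ ↦ K₁) (volume.restrict (Set.Ioo 0 t)) := by simp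
    have hi4 : Integrable (fun s ↦ K₁ - α * ‖w s‖ ^ 2) (volume.restrict (Set.Ioo 0 t)) :=
      hi3.sub (hi1.const_mul α)
    have h2 : ∫ s in Set.Ioo 0 t, 2 * dy s (w s)
        ≤ ∫ s in Set.Ioo 0 t, (K₁ - α * ‖w s‖ ^ 2 + 2 * ω * ‖y s‖ ^ 2) :=
      integral_mono_ae (hi0.const_mul 2) (hi4.add (hi2.const_mul _))
        (ae_mono hle hpt)
    rw [integral_add hi4 (hi2.const_mul _),
      integral_sub hi3 (hi1.const_mul α), integral_const_mul, integral_const_mul,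
      integral_const_mul, setIntegral_const] at h2
    simp only [Real.volume_real_Ioo, sub_zero, smul_eq_mul, max_eq_left ht.1] at h2
    rw [intervalIntegral.integral_of_le ht.1, integral_Ioc_eq_integral_Ioo] at h1 ⊢
    rw [hy0] at h1
    have h3 : t * K₁ ≤ K₁ * S := by nlinarith [ht.2]
    linarith
  have hgr := integral_le_gronwallBound (K := ‖P.y₀‖ ^ 2 + K₁ * S) (L := 2 * ω) hyc
    (fun t ht ↦ by
      have : 0 ≤ ∫ s in Set.Ioo 0 t, ‖w s‖ ^ 2 := integral_nonneg fun _ ↦ by positivity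
      have := henergy t ht
      nlinarith)
  have hTm : T ∈ Set.Icc 0 T := ⟨hT0, le_rfl⟩
  have h1 := (hgr T hTm).trans
    (gronwallBound_mono (δ := 0) le_rfl (by positivity) (by positivity) hTS)
  have h2 := henergy T hTm
  rw [le_div_iff₀ hα]
  have h3 : 2 * ω * ∫ s in (0 : ℝ)..T, ‖y s‖ ^ 2
      ≤ 2 * ω * gronwallBound 0 (2 * ω) (‖P.y₀‖ ^ 2 + K₁ * S) S := by gcongr
  nlinarith [sq_nonneg ‖y T‖]

/-- A priori bound for control, state and time derivative of all admissible states on intervals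
of length at most `S`. -/
theorem exists_eLpNorm_le (P : ParabolicControlProblem V H ϱ)
    (hbounded : Bornology.IsBounded P.Uad) (S : ℝ) :
    ∃ C : ℝ, 0 ≤ C ∧ ∀ T : ℝ, 0 ≤ T → T ≤ S → ∀ u y w dy, P.IsAdmissible T u → y 0 = P.y₀ →
      P.IsW T y w dy →
      (∀ᵐ t ∂volume.restrict (Set.Ioo 0 T), dy t + P.a (w t) = P.B (u t)) →
      eLpNorm u 2 (volume.restrict (Set.Ioo 0 T)) ≤ ENNReal.ofReal C ∧
      eLpNorm w 2 (volume.restrict (Set.Ioo 0 T)) ≤ ENNReal.ofReal C ∧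
      eLpNorm dy 2 (volume.restrict (Set.Ioo 0 T)) ≤ ENNReal.ofReal C := by
  obtain ⟨M, hM⟩ := isBounded_iff_forall_norm_le.1 hbounded
  obtain ⟨C, hC⟩ := P.exists_integral_norm_sq_le hbounded S
  set C₁ := Real.sqrt (M ^ 2 * S)
  set C₂ := Real.sqrt C
  have hC₁ : 0 ≤ C₁ := Real.sqrt_nonneg _
  have hC₂ : 0 ≤ C₂ := Real.sqrt_nonneg _
  have hB := norm_nonneg P.B
  have ha := norm_nonneg P.a
  refine ⟨C₁ + C₂ + (‖P.B‖ * C₁ + ‖P.a‖ * C₂), by positivity, ?_⟩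
  intro T hT0 hTS u y w dy hu hy0 hW heq
  have h1 : eLpNorm u 2 (volume.restrict (Set.Ioo 0 T)) ≤ ENNReal.ofReal C₁ := by
    refine eLpNorm_two_le_of_integral_sq_le hu.1 ?_
    have : ∫ t in Set.Ioo 0 T, ‖u t‖ ^ 2 ≤ ∫ _ in Set.Ioo 0 T, M ^ 2 := by
      refine integral_mono_ae (hu.1.integrable_norm_pow (by norm_num)) (by simp) ?_
      filter_upwards [hu.2] with t ht
      have := hM _ ht
      gcongr
    refine this.trans ?_
    simp only [setIntegral_const, Real.volume_real_Ioo, sub_zero, smul_eq_mul, max_eq_left hT0]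
    nlinarith [sq_nonneg M]
  have h2 : eLpNorm w 2 (volume.restrict (Set.Ioo 0 T)) ≤ ENNReal.ofReal C₂ :=
    eLpNorm_two_le_of_integral_sq_le hW.memLp_w (hC T hT0 hTS u y w dy hu hy0 hW heq)
  have h3 : eLpNorm dy 2 (volume.restrict (Set.Ioo 0 T))
      ≤ ENNReal.ofReal (‖P.B‖ * C₁ + ‖P.a‖ * C₂) := by
    have e : dy =ᵐ[volume.restrict (Set.Ioo 0 T)] (fun t ↦ P.B (u t)) - fun t ↦ P.a (w t) := by
      filter_upwards [heq] with t ht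
      simp [← ht]
    rw [eLpNorm_congr_ae e, ENNReal.ofReal_add (by positivity) (by positivity),
      ENNReal.ofReal_mul hB, ENNReal.ofReal_mul ha]
    refine (eLpNorm_sub_le (P.B.continuous.comp_aestronglyMeasurable hu.1.1)
      (P.a.continuous.comp_aestronglyMeasurable hW.memLp_w.1) (by norm_num)).trans ?_
    refine add_le_add ?_ ?_
    · refine (eLpNorm_le_mul_eLpNorm_of_ae_le_mul (.of_forall fun t ↦ P.B.le_opNorm _) 2).trans ?_
      gcongr
    · refine (eLpNorm_le_mul_eLpNorm_of_ae_le_mul (.of_forall fun t ↦ P.a.le_opNorm _) 2).trans ?_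
      gcongr
  refine ⟨h1.trans ?_, h2.trans ?_, h3.trans ?_⟩ <;> refine ENNReal.ofReal_le_ofReal ?_ <;>
    nlinarith [mul_nonneg hB hC₁, mul_nonneg ha hC₂]

/-! ### Nested convex sets in Hilbert spaces -/

/-- Elements of `C n` whose norms are almost minimal form a Cauchy sequence, by the
parallelogram law. This replaces weak compactness. -/
theorem exists_cauchySeq_of_antitone_convex {E : Type*} [NormedAddCommGroup E]
    [InnerProductSpace ℝ E] {C : ℕ → Set E} (hanti : Antitone C) (hconv : ∀ n, Convex ℝ (C n))
    (hne : ∀ n, (C n).Nonempty) {R : ℝ} (hR : ∀ n, ∀ x ∈ C n, ‖x‖ ≤ R) :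
    ∃ x : ℕ → E, (∀ n, x n ∈ C n) ∧ CauchySeq x := by
  set r : ℕ → ℝ := fun n ↦ sInf ((fun x ↦ ‖x‖ ^ 2) '' C n) with hr
  have hbdd : ∀ n, BddBelow ((fun x : E ↦ ‖x‖ ^ 2) '' C n) := fun n ↦
    ⟨0, by rintro _ ⟨x, _, rfl⟩; positivity⟩
  have hle : ∀ n, ∀ x ∈ C n, r n ≤ ‖x‖ ^ 2 := fun n x hx ↦ csInf_le (hbdd n) ⟨x, hx, rfl⟩
  have hmono : Monotone r := fun n m hnm ↦
    csInf_le_csInf (hbdd n) ((hne m).image _) (Set.image_mono (hanti hnm))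
  have hrR : BddAbove (Set.range r) := by
    refine ⟨R ^ 2, ?_⟩
    rintro _ ⟨n, rfl⟩
    obtain ⟨x, hx⟩ := hne n
    have := hR n x hx
    exact (hle n x hx).trans (by gcongr)
  have hlim := tendsto_atTop_ciSup hmono hrR
  set L := ⨆ n, r n
  have hL : ∀ n, r n ≤ L := fun n ↦ le_ciSup hrR n
  have hx : ∀ n, ∃ x ∈ C n, ‖x‖ ^ 2 < r n + 1 / ((n : ℝ) + 1) := fun n ↦ by
    obtain ⟨_, ⟨x, hx, rfl⟩, h⟩ := exists_lt_of_csInf_lt ((hne n).image fun x ↦ ‖x‖ ^ 2)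
      (lt_add_of_pos_right (r n) (by positivity : 0 < 1 / ((n : ℝ) + 1)))
    exact ⟨x, hx, h⟩
  choose x hxC hxlt using hx
  refine ⟨x, hxC, ?_⟩
  have key : ∀ N n, N ≤ n → dist (x N) (x n)
      ≤ Real.sqrt (4 * (1 / ((N : ℝ) + 1)) + 2 * (L - r N)) := by
    intro N n hNn
    refine Real.le_sqrt_of_sq_le ?_
    -- the midpoint lies in `C N`, so that its norm is bounded below by the infimum there
    have hmid : (1 / 2 : ℝ) • x N + (1 / 2 : ℝ) • x n ∈ C N :=
      hconv N (hxC N) (hanti hNn (hxC n)) (by norm_num) (by norm_num) (by norm_num)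
    have h1 := hle N _ hmid
    rw [← smul_add, norm_smul, mul_pow] at h1
    have h2 := parallelogram_law_with_norm ℝ (x N) (x n)
    have h3 : 1 / ((n : ℝ) + 1) ≤ 1 / ((N : ℝ) + 1) := Nat.one_div_le_one_div hNn
    have h4 := hxlt N
    have h5 := hxlt n
    have h6 := hL n
    rw [dist_eq_norm]
    norm_num at h1
    nlinarith
  refine cauchySeq_of_le_tendsto_0' _ key ?_
  have h0 : Tendsto (fun N : ℕ ↦ 4 * (1 / ((N : ℝ) + 1)) + 2 * (L - r N)) atTop
      (𝓝 (4 * 0 + 2 * (L - L))) :=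
    (tendsto_one_div_add_atTop_nhds_zero_nat.const_mul 4).add
      ((tendsto_const_nhds.sub hlim).const_mul 2)
  have := h0.sqrt
  simpa using this

/-! ### Dilation in time -/

theorem map_mul_left_restrict_Ioo {S T : ℝ} (hS : 0 < S) (hT : 0 < T) :
    Measure.map (fun t ↦ T / S * t) (volume.restrict (Set.Ioo 0 S))
      = ENNReal.ofReal (S / T) • volume.restrict (Set.Ioo 0 T) := by
  have hθ : 0 < T / S := by positivity
  have h := Real.map_volume_mul_left hθ.ne'
  have hpre : (fun t ↦ T / S * t) ⁻¹' Set.Ioo 0 T = Set.Ioo 0 S := by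
    ext t
    simp only [Set.mem_preimage, Set.mem_Ioo]
    rw [div_mul_eq_mul_div, div_lt_iff₀ hS, mul_lt_mul_iff_right₀ hT]
    constructor
    · rintro ⟨h1, h2⟩
      exact ⟨by
        have := (div_pos_iff_of_pos_right hS).1 h1
        exact (mul_pos_iff_of_pos_left hT).1 this, h2⟩
    · rintro ⟨h1, h2⟩
      exact ⟨by positivity, h2⟩
  rw [← hpre, ← Measure.restrict_map (measurable_const_mul _) measurableSet_Ioo, h,
    Measure.restrict_smul, abs_of_pos (by positivity), inv_div]

theorem ae_comp_mul_left {S T : ℝ} (hS : 0 < S) (hT : 0 < T) {p : ℝ → Prop}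
    (hp : ∀ᵐ t ∂volume.restrict (Set.Ioo 0 T), p t) :
    ∀ᵐ t ∂volume.restrict (Set.Ioo 0 S), p (T / S * t) := by
  refine ae_of_ae_map (f := fun t ↦ T / S * t) (measurable_const_mul _).aemeasurable ?_
  rw [map_mul_left_restrict_Ioo hS hT]
  exact Measure.ae_smul_measure hp _

theorem memLp_comp_mul_left {E : Type*} [NormedAddCommGroup E] {S T : ℝ} (hS : 0 < S)
    (hT : 0 < T) {f : ℝ → E} (hf : MemLp f 2 (volume.restrict (Set.Ioo 0 T))) :
    MemLp (fun t ↦ f (T / S * t)) 2 (volume.restrict (Set.Ioo 0 S)) := by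
  refine MemLp.comp_of_map (f := fun t ↦ T / S * t) ?_ (measurable_const_mul _).aemeasurable
  rw [map_mul_left_restrict_Ioo hS hT]
  exact hf.smul_measure (by simp)

/-- The factor `2` is `√4`, from the bound `S / T ≤ 4` for the density of the image measure. -/
theorem eLpNorm_comp_mul_left_le {E : Type*} [NormedAddCommGroup E] {S T C : ℝ} (hS : 0 < S)
    (hT : 0 < T) (hST : S ≤ 4 * T) {f : ℝ → E}
    (hf : MemLp f 2 (volume.restrict (Set.Ioo 0 T)))
    (hC : eLpNorm f 2 (volume.restrict (Set.Ioo 0 T)) ≤ ENNReal.ofReal C) :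
    eLpNorm (fun t ↦ f (T / S * t)) 2 (volume.restrict (Set.Ioo 0 S))
      ≤ ENNReal.ofReal (2 * C) := by
  have h1 : AEStronglyMeasurable f
      (Measure.map (fun t ↦ T / S * t) (volume.restrict (Set.Ioo 0 S))) := by
    rw [map_mul_left_restrict_Ioo hS hT]
    exact (hf.smul_measure (c := ENNReal.ofReal (S / T)) (by simp)).1
  have h2 := eLpNorm_map_measure (p := 2) h1 (measurable_const_mul (T / S)).aemeasurable
  have e : (fun t ↦ f (T / S * t)) = f ∘ fun t ↦ T / S * t := rfl
  rw [e, ← h2, map_mul_left_restrict_Ioo hS hT, eLpNorm_smul_measure_of_ne_top (by simp),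
    smul_eq_mul, ENNReal.ofReal_mul (by norm_num)]
  refine mul_le_mul' ?_ hC
  have h3 : S / T ≤ 4 := by rw [div_le_iff₀ hT]; linarith
  have h4 : (0 : ℝ) ≤ S / T := by positivity
  rw [ENNReal.ofReal_rpow_of_nonneg h4 (by positivity)]
  refine ENNReal.ofReal_le_ofReal ?_
  have h5 : ((1 / 2 : ℝ≥0∞).toReal) = 1 / 2 := by simp
  rw [h5, ← Real.sqrt_eq_rpow]
  exact Real.sqrt_le_iff.2 ⟨by norm_num, by linarith⟩

theorem IsW.comp_mul_left {P : ParabolicControlProblem V H ϱ} {S T : ℝ} (hS : 0 < S)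
    (hT : 0 < T) {y : ℝ → H} {w : ℝ → V} {dy : ℝ → StrongDual ℝ V} (h : P.IsW T y w dy) :
    P.IsW S (fun t ↦ y (T / S * t)) (fun t ↦ w (T / S * t))
      (fun t ↦ (T / S) • dy (T / S * t)) := by
  have hθ : 0 < T / S := by positivity
  have hmaps : ∀ t ∈ Set.Icc 0 S, T / S * t ∈ Set.Icc 0 T := fun t ht ↦ by
    refine ⟨mul_nonneg hθ.le ht.1, ?_⟩
    calc T / S * t ≤ T / S * S := by gcongr; exact ht.2
      _ = T := by field_simp
  exact {
    continuousOn := h.continuousOn.comp (by fun_prop) hmaps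
    memLp_w := memLp_comp_mul_left hS hT h.memLp_w
    eq_w := ae_comp_mul_left hS hT h.eq_w
    memLp_dy := (memLp_comp_mul_left hS hT h.memLp_dy).const_smul (T / S)
    primitive t ht := by
      rw [intervalIntegral.integral_smul, intervalIntegral.smul_integral_comp_mul_left,
        mul_zero]
      exact h.primitive _ (hmaps t ht) }

/-! ### Limits in `W(0,T)` -/

/-- For zero initial value, `2⟨∂ₜ y, w⟩ ≤ ‖∂ₜ y‖² + ‖w‖²` turns the energy inequality into the
bound of `C([0,T]; H)` by `L²((0,T); V)` and `H¹((0,T); V*)`. -/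
theorem IsW.norm_sq_le {P : ParabolicControlProblem V H ϱ} {T : ℝ} {y : ℝ → H}
    {w : ℝ → V} {dy : ℝ → StrongDual ℝ V} (h : P.IsW T y w dy) (h0 : y 0 = 0) {t : ℝ}
    (ht : t ∈ Set.Icc 0 T) :
    ‖y t‖ ^ 2 ≤ (∫ s in Set.Ioo 0 T, ‖dy s‖ ^ 2) + ∫ s in Set.Ioo 0 T, ‖w s‖ ^ 2 := by
  have h1 := h.energy_le ht
  rw [h0, intervalIntegral.integral_of_le ht.1, integral_Ioc_eq_integral_Ioo] at h1
  have i1 : Integrable (fun s ↦ ‖dy s‖ ^ 2) (volume.restrict (Set.Ioo 0 T)) :=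
    h.memLp_dy.integrable_norm_pow (by norm_num)
  have i2 : Integrable (fun s ↦ ‖w s‖ ^ 2) (volume.restrict (Set.Ioo 0 T)) :=
    h.memLp_w.integrable_norm_pow (by norm_num)
  have i3 := integrable_pairing h.memLp_dy h.memLp_w
  have hle := restrict_Ioo_mono ht.2
  have h2 : ∫ s in Set.Ioo 0 t, 2 * dy s (w s)
      ≤ ∫ s in Set.Ioo 0 t, (‖dy s‖ ^ 2 + ‖w s‖ ^ 2) := by
    refine integral_mono ((i3.mono_measure hle).const_mul 2)
      ((i1.add i2).mono_measure hle) fun s ↦ ?_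
    have h3 := (le_abs_self _).trans ((dy s).le_opNorm (w s))
    simp only
    nlinarith [sq_nonneg (‖dy s‖ - ‖w s‖)]
  have h4 : ∫ s in Set.Ioo 0 t, (‖dy s‖ ^ 2 + ‖w s‖ ^ 2)
      ≤ ∫ s in Set.Ioo 0 T, (‖dy s‖ ^ 2 + ‖w s‖ ^ 2) :=
    integral_mono_measure hle (.of_forall fun s ↦ by positivity) (i1.add i2)
  rw [integral_const_mul] at h2
  rw [integral_add i1 i2] at h4
  simp only [norm_zero] at h1
  linarith

theorem integral_norm_sq_eq_norm_toLp_sq {α E : Type*} [MeasurableSpace α] {μ : Measure α}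
    [NormedAddCommGroup E] {f : α → E} (hf : MemLp f 2 μ) :
    ∫ t, ‖f t‖ ^ 2 ∂μ = ‖hf.toLp f‖ ^ 2 := by
  have h0 : 0 ≤ ∫ t, ‖f t‖ ^ 2 ∂μ := integral_nonneg fun _ ↦ by positivity
  rw [Lp.norm_toLp, hf.eLpNorm_eq_integral_rpow_norm (by simp) (by simp)]
  simp only [ENNReal.toReal_ofNat, Real.rpow_two]
  rw [ENNReal.toReal_ofReal (by positivity), ← one_div, ← Real.sqrt_eq_rpow, Real.sq_sqrt h0]

theorem IsW.dist_sq_le {P : ParabolicControlProblem V H ϱ} {T : ℝ} {y₁ y₂ : ℝ → H}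
    {w₁ w₂ : ℝ → V} {dy₁ dy₂ : ℝ → StrongDual ℝ V} (h₁ : P.IsW T y₁ w₁ dy₁)
    (h₂ : P.IsW T y₂ w₂ dy₂) (h0 : y₁ 0 = y₂ 0) {t : ℝ} (ht : t ∈ Set.Icc 0 T) :
    dist (y₁ t) (y₂ t) ^ 2 ≤ dist (h₁.memLp_dy.toLp dy₁) (h₂.memLp_dy.toLp dy₂) ^ 2
      + dist (h₁.memLp_w.toLp w₁) (h₂.memLp_w.toLp w₂) ^ 2 := by
  have h := (h₁.linComb h₂ 1 (-1)).norm_sq_le (by simp [h0]) ht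
  have e : ∀ s, (1 : ℝ) • dy₁ s + (-1 : ℝ) • dy₂ s = dy₁ s - dy₂ s := fun s ↦ by
    ext v; simp [sub_eq_add_neg]
  simp only [e] at h
  simp only [one_smul, neg_smul, ← sub_eq_add_neg] at h
  rw [dist_eq_norm, dist_eq_norm, dist_eq_norm, ← MemLp.toLp_sub, ← MemLp.toLp_sub,
    ← integral_norm_sq_eq_norm_toLp_sq, ← integral_norm_sq_eq_norm_toLp_sq]
  exact h

/-- `W(0,T)` with fixed initial value is closed: if `w` and `∂ₜ y` converge in `L²`, then `y`
converges uniformly in `H`. -/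
theorem exists_isW_of_tendsto (P : ParabolicControlProblem V H ϱ) {T : ℝ} (hT : 0 ≤ T)
    {y : ℕ → ℝ → H} {w : ℕ → ℝ → V} {dy : ℕ → ℝ → StrongDual ℝ V} {y₀ : H}
    (h : ∀ n, P.IsW T (y n) (w n) (dy n)) (h0 : ∀ n, y n 0 = y₀)
    {W : Lp V 2 (volume.restrict (Set.Ioo 0 T))}
    {D : Lp (StrongDual ℝ V) 2 (volume.restrict (Set.Ioo 0 T))}
    (hW : Tendsto (fun n ↦ (h n).memLp_w.toLp (w n)) atTop (𝓝 W))
    (hD : Tendsto (fun n ↦ (h n).memLp_dy.toLp (dy n)) atTop (𝓝 D)) :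
    ∃ z : ℝ → H, P.IsW T z W D ∧ ∀ t ∈ Set.Icc 0 T, Tendsto (fun n ↦ y n t) atTop (𝓝 (z t)) := by
  have hunif : UniformCauchySeqOn y atTop (Set.Icc 0 T) := by
    rw [Metric.uniformCauchySeqOn_iff]
    intro ε hε
    obtain ⟨N₁, hN₁⟩ := Metric.cauchySeq_iff.1 hW.cauchySeq (ε / 2) (by positivity)
    obtain ⟨N₂, hN₂⟩ := Metric.cauchySeq_iff.1 hD.cauchySeq (ε / 2) (by positivity)
    refine ⟨max N₁ N₂, fun m hm n hn t ht ↦ ?_⟩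
    have h1 := hN₁ m (le_of_max_le_left hm) n (le_of_max_le_left hn)
    have h2 := hN₂ m (le_of_max_le_right hm) n (le_of_max_le_right hn)
    have h3 := (h m).dist_sq_le (h n) ((h0 m).trans (h0 n).symm) ht
    refine lt_of_pow_lt_pow_left₀ 2 hε.le (h3.trans_lt ?_)
    have h4 := pow_lt_pow_left₀ h1 dist_nonneg two_ne_zero
    have h5 := pow_lt_pow_left₀ h2 dist_nonneg two_ne_zero
    nlinarith
  have hlim : ∀ t, ∃ x, t ∈ Set.Icc 0 T → Tendsto (fun n ↦ y n t) atTop (𝓝 x) := fun t ↦ by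
    by_cases ht : t ∈ Set.Icc 0 T
    · obtain ⟨x, hx⟩ := cauchySeq_tendsto_of_complete (hunif.cauchySeq ht)
      exact ⟨x, fun _ ↦ hx⟩
    · exact ⟨0, fun h ↦ absurd h ht⟩
  choose z hz using hlim
  refine ⟨z, ?_, hz⟩
  have hz0 : z 0 = y₀ := by
    refine tendsto_nhds_unique (hz 0 ⟨le_rfl, hT⟩) ?_
    simp only [h0]
    exact tendsto_const_nhds
  have hmD : MemLp D 2 (volume.restrict (Set.Ioo 0 T)) := Lp.memLp D
  refine ⟨?_, Lp.memLp W, ?_, hmD, fun t ht ↦ ?_⟩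
  · exact (hunif.tendstoUniformlyOn_of_tendsto hz).continuousOn
      (Frequently.of_forall fun n ↦ (h n).continuousOn)
  · obtain ⟨ns, hmono, hns⟩ := (tendstoInMeasure_of_tendsto_Lp hW).exists_seq_tendsto_ae
    filter_upwards [hns, ae_all_iff.2 fun n ↦ (h n).eq_w,
      ae_all_iff.2 fun n ↦ (h n).memLp_w.coeFn_toLp, ae_restrict_mem measurableSet_Ioo]
      with t h1 h2 h3 ht
    refine tendsto_nhds_unique
      ((hz t ⟨ht.1.le, ht.2.le⟩).comp hmono.tendsto_atTop) ?_
    refine ((P.ι.continuous.tendsto _).comp h1).congr fun n ↦ ?_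
    simp only [Function.comp, h2, h3]
  · have hle := restrict_Ioo_mono ht.2
    have hL1 : Tendsto (fun n ↦ eLpNorm (dy n - (D : ℝ → StrongDual ℝ V)) 1
        (volume.restrict (Set.Ioo 0 T))) atTop
        (𝓝 0) := by
      have h1 : Tendsto (fun n ↦ eLpNorm (dy n - (D : ℝ → StrongDual ℝ V)) 2
        (volume.restrict (Set.Ioo 0 T))) atTop
          (𝓝 0) := by
        have := (Lp.tendsto_Lp_iff_tendsto_eLpNorm' _ _).1 hD
        refine this.congr fun n ↦ eLpNorm_congr_ae ?_
        exact (h n).memLp_dy.coeFn_toLp.sub EventuallyEq.rfl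
      have h2 := ENNReal.Tendsto.mul_const (b := (volume.restrict (Set.Ioo 0 T) Set.univ) ^
        (1 / (1 : ℝ≥0∞).toReal - 1 / (2 : ℝ≥0∞).toReal)) h1
        (Or.inr (ENNReal.rpow_ne_top_of_nonneg (by norm_num) (by simp)))
      rw [zero_mul] at h2
      refine tendsto_of_tendsto_of_tendsto_of_le_of_le tendsto_const_nhds h2
        (fun _ ↦ zero_le) fun n ↦ ?_
      exact eLpNorm_le_eLpNorm_mul_rpow_measure_univ (by norm_num)
        ((h n).memLp_dy.1.sub hmD.1)
    have hint := tendsto_setIntegral_of_L1' (D : ℝ → StrongDual ℝ V)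
      hmD.1
      (.of_forall fun n ↦ (h n).memLp_dy.integrable (by norm_num)) hL1 (Set.Ioo 0 t)
    have hr : (volume.restrict (Set.Ioo 0 T)).restrict (Set.Ioo 0 t)
        = volume.restrict (Set.Ioo 0 t) := by
      rw [Measure.restrict_restrict measurableSet_Ioo,
        Set.inter_eq_left.2 (Set.Ioo_subset_Ioo_right ht.2)]
    rw [hr] at hint
    rw [hz0, intervalIntegral.integral_of_le ht.1, integral_Ioc_eq_integral_Ioo]
    refine tendsto_nhds_unique ((P.continuous_toDual.tendsto _).comp (hz t ht)) ?_
    refine (tendsto_const_nhds.add hint).congr fun n ↦ ?_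
    simp only [Function.comp]
    rw [(h n).primitive t ht, h0, intervalIntegral.integral_of_le ht.1,
      integral_Ioc_eq_integral_Ioo]

/-! ### Approximate states -/

theorem convex_Uad (P : ParabolicControlProblem V H ϱ) : Convex ℝ P.Uad := by
  intro u hu v hv a b ha hb hab
  filter_upwards [hu, hv, Lp.coeFn_add (a • u) (b • v), Lp.coeFn_smul a u, Lp.coeFn_smul b v]
    with x h1 h2 h3 h4 h5
  rw [h3, Pi.add_apply, h4, h5]
  simp only [Pi.smul_apply, smul_eq_mul]
  have e : P.ua x = a * P.ua x + b * P.ua x := by rw [← add_mul, hab, one_mul]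
  have e' : P.ub x = a * P.ub x + b * P.ub x := by rw [← add_mul, hab, one_mul]
  rw [e, e']
  constructor
  · exact add_le_add (mul_le_mul_of_nonneg_left h1.1 ha) (mul_le_mul_of_nonneg_left h2.1 hb)
  · exact add_le_add (mul_le_mul_of_nonneg_left h1.2 ha) (mul_le_mul_of_nonneg_left h2.2 hb)

theorem isClosed_Uad (P : ParabolicControlProblem V H ϱ) : IsClosed P.Uad := by
  refine IsSeqClosed.isClosed fun u v hu huv ↦ ?_
  obtain ⟨ns, _, hns⟩ := (tendstoInMeasure_of_tendsto_Lp huv).exists_seq_tendsto_ae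
  have hall : ∀ᵐ x ∂ϱ, ∀ n, P.ua x ≤ u n x ∧ u n x ≤ P.ub x := ae_all_iff.2 hu
  filter_upwards [hns, hall] with x h1 h2
  exact ⟨ge_of_tendsto' h1 fun n ↦ (h2 _).1, le_of_tendsto' h1 fun n ↦ (h2 _).2⟩

theorem eLpNorm_smul_add_smul_le {α E : Type*} [MeasurableSpace α] {μ : Measure α}
    [NormedAddCommGroup E] [NormedSpace ℝ E] {f g : α → E} (hf : AEStronglyMeasurable f μ)
    (hg : AEStronglyMeasurable g μ) {a b : ℝ} (ha : 0 ≤ a) (hb : 0 ≤ b) (hab : a + b = 1)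
    {C : ℝ≥0∞} (hfC : eLpNorm f 2 μ ≤ C) (hgC : eLpNorm g 2 μ ≤ C) :
    eLpNorm (a • f + b • g) 2 μ ≤ C := by
  refine (eLpNorm_add_le (hf.const_smul a) (hg.const_smul b) (by norm_num)).trans ?_
  rw [eLpNorm_const_smul, eLpNorm_const_smul, Real.enorm_of_nonneg ha, Real.enorm_of_nonneg hb]
  calc ENNReal.ofReal a * eLpNorm f 2 μ + ENNReal.ofReal b * eLpNorm g 2 μ
      ≤ ENNReal.ofReal a * C + ENNReal.ofReal b * C := by gcongr
    _ = C := by rw [← add_mul, ← ENNReal.ofReal_add ha hb, hab, ENNReal.ofReal_one, one_mul]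

/-- The pairs of a control `u ∈ U_ad(0,S)` and an `L²((0,S); V)`-function `w` of norm at most `R`
for which `w` represents some `y ∈ W(0,S)` with `y(0) = y₀` that solves the state equation up to a
residual of norm at most `ε` in `L²((0,S); V*)` and satisfies `‖y(S) - yd‖ ≤ r + ε`. The pairs are
elements of the `L²`-product, so that the parallelogram law is available. -/
def approxSet (P : ParabolicControlProblem V H ϱ) (S r R ε : ℝ) :
    Set (WithLp 2 (Lp (Lp ℝ 2 ϱ) 2 (volume.restrict (Set.Ioo 0 S)) ×
      Lp V 2 (volume.restrict (Set.Ioo 0 S)))) :=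
  {x | ‖x‖ ≤ R ∧ (∀ᵐ t ∂volume.restrict (Set.Ioo 0 S), x.fst t ∈ P.Uad) ∧
    ∃ y dy, y 0 = P.y₀ ∧ P.IsW S y x.snd dy ∧
      eLpNorm (fun t ↦ dy t - (P.B (x.fst t) - P.a (x.snd t))) 2 (volume.restrict (Set.Ioo 0 S))
        ≤ ENNReal.ofReal ε ∧
      ‖y S - P.yd‖ ≤ r + ε}

theorem approxSet_mono (P : ParabolicControlProblem V H ϱ) (S r R : ℝ) {ε ε' : ℝ} (h : ε ≤ ε') :
    P.approxSet S r R ε ⊆ P.approxSet S r R ε' := by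
  rintro x ⟨h1, h2, y, dy, h3, h4, h5, h6⟩
  exact ⟨h1, h2, y, dy, h3, h4, h5.trans (ENNReal.ofReal_le_ofReal h), h6.trans (by linarith)⟩

theorem convex_approxSet (P : ParabolicControlProblem V H ϱ) (S r R : ℝ) {ε : ℝ} :
    Convex ℝ (P.approxSet S r R ε) := by
  rintro x ⟨h1, h2, y, dy, h3, h4, h5, h6⟩ x' ⟨h1', h2', y', dy', h3', h4', h5', h6'⟩ a b ha hb hab
  have eU : (a • x + b • x').fst =ᵐ[volume.restrict (Set.Ioo 0 S)]
      fun t ↦ a • x.fst t + b • x'.fst t := by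
    filter_upwards [Lp.coeFn_add (a • x.fst) (b • x'.fst), Lp.coeFn_smul a x.fst,
      Lp.coeFn_smul b x'.fst] with t e1 e2 e3
    rw [WithLp.add_fst, WithLp.smul_fst, WithLp.smul_fst, e1, Pi.add_apply, e2, e3]
    rfl
  have eW : (a • x + b • x').snd =ᵐ[volume.restrict (Set.Ioo 0 S)]
      fun t ↦ a • x.snd t + b • x'.snd t := by
    filter_upwards [Lp.coeFn_add (a • x.snd) (b • x'.snd), Lp.coeFn_smul a x.snd,
      Lp.coeFn_smul b x'.snd] with t e1 e2 e3
    rw [WithLp.add_snd, WithLp.smul_snd, WithLp.smul_snd, e1, Pi.add_apply, e2, e3]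
    rfl
  refine ⟨?_, ?_, fun t ↦ a • y t + b • y' t, fun t ↦ a • dy t + b • dy' t, ?_,
    (h4.linComb h4' a b).congr eW.symm EventuallyEq.rfl, ?_, ?_⟩
  · have := convex_closedBall (0 : WithLp 2 (Lp (Lp ℝ 2 ϱ) 2 (volume.restrict (Set.Ioo 0 S)) ×
      Lp V 2 (volume.restrict (Set.Ioo 0 S)))) R (mem_closedBall_zero_iff.2 h1)
      (mem_closedBall_zero_iff.2 h1') ha hb hab
    exact mem_closedBall_zero_iff.1 this
  · filter_upwards [eU, h2, h2'] with t e1 e2 e3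
    rw [e1]
    exact P.convex_Uad e2 e3 ha hb hab
  · simp only [h3, h3', ← add_smul, hab, one_smul]
  · set f : ℝ → StrongDual ℝ V := fun t ↦ dy t - (P.B (x.fst t) - P.a (x.snd t)) with hf
    set f' : ℝ → StrongDual ℝ V := fun t ↦ dy' t - (P.B (x'.fst t) - P.a (x'.snd t)) with hf'
    have e : (fun t ↦ a • dy t + b • dy' t - (P.B ((a • x + b • x').fst t)
        - P.a ((a • x + b • x').snd t))) =ᵐ[volume.restrict (Set.Ioo 0 S)] a • f + b • f' := by
      filter_upwards [eU, eW] with t e1 e2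
      rw [e1, e2]
      simp only [map_add, map_smul, hf, hf', Pi.add_apply, Pi.smul_apply, smul_sub]
      abel
    have hmf : AEStronglyMeasurable f (volume.restrict (Set.Ioo 0 S)) :=
      h4.memLp_dy.1.sub ((P.B.continuous.comp_aestronglyMeasurable (Lp.memLp x.fst).1).sub
        (P.a.continuous.comp_aestronglyMeasurable (Lp.memLp x.snd).1))
    have hmf' : AEStronglyMeasurable f' (volume.restrict (Set.Ioo 0 S)) :=
      h4'.memLp_dy.1.sub ((P.B.continuous.comp_aestronglyMeasurable (Lp.memLp x'.fst).1).sub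
        (P.a.continuous.comp_aestronglyMeasurable (Lp.memLp x'.snd).1))
    rw [eLpNorm_congr_ae e]
    exact eLpNorm_smul_add_smul_le hmf hmf' ha hb hab h5 h5'
  · have e : a • y S + b • y' S - P.yd = a • (y S - P.yd) + b • (y' S - P.yd) := by
      have : P.yd = a • P.yd + b • P.yd := by rw [← add_smul, hab, one_smul]
      conv_lhs => rw [this]
      simp only [smul_sub]
      abel
    rw [e]
    calc _ ≤ ‖a • (y S - P.yd)‖ + ‖b • (y' S - P.yd)‖ := norm_add_le _ _
      _ = a * ‖y S - P.yd‖ + b * ‖y' S - P.yd‖ := by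
        rw [norm_smul, norm_smul, Real.norm_of_nonneg ha, Real.norm_of_nonneg hb]
      _ ≤ a * (r + ε) + b * (r + ε) := by gcongr
      _ = r + ε := by rw [← add_mul, hab, one_mul]

/-- The approximate states for `ε → 0` contain a sequence converging to an exact state. -/
theorem exists_distance_le_of_approxSet_nonempty (P : ParabolicControlProblem V H ϱ) {S r R : ℝ}
    (hS : 0 ≤ S) (hne : ∀ ε : ℝ, 0 < ε → (P.approxSet S r R ε).Nonempty) :
    ∃ d ∈ P.distances S, d ≤ r := by
  set ε : ℕ → ℝ := fun n ↦ 1 / ((n : ℝ) + 1) with hε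
  have hεpos : ∀ n, 0 < ε n := fun n ↦ by positivity
  have hεlim : Tendsto ε atTop (𝓝 0) := tendsto_one_div_add_atTop_nhds_zero_nat
  obtain ⟨x, hxC, hx⟩ := exists_cauchySeq_of_antitone_convex
    (C := fun n ↦ P.approxSet S r R (ε n))
    (fun n m hnm ↦ P.approxSet_mono S r R (Nat.one_div_le_one_div hnm))
    (fun n ↦ P.convex_approxSet S r R) (fun n ↦ hne _ (hεpos n))
    (R := R) (fun n x hx ↦ hx.1)
  obtain ⟨x', hx'⟩ := cauchySeq_tendsto_of_complete hx
  choose hR hU y dy hy0 hW hres hd using hxC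
  have hUlim : Tendsto (fun n ↦ (x n).fst) atTop (𝓝 x'.fst) :=
    ((WithLp.prod_continuous_ofLp 2 _ _).fst.tendsto x').comp hx'
  have hWlim : Tendsto (fun n ↦ (x n).snd) atTop (𝓝 x'.snd) :=
    ((WithLp.prod_continuous_ofLp 2 _ _).snd.tendsto x').comp hx'
  -- the right-hand side `B u - A w` as an element of `L²((0, S); V*)`
  set F : ℕ → Lp (StrongDual ℝ V) 2 (volume.restrict (Set.Ioo 0 S)) := fun n ↦
    P.B.compLp (x n).fst - P.a.compLp (x n).snd with hF
  set D : Lp (StrongDual ℝ V) 2 (volume.restrict (Set.Ioo 0 S)) :=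
    P.B.compLp x'.fst - P.a.compLp x'.snd with hDdef
  have hcoe : ∀ (u : Lp (Lp ℝ 2 ϱ) 2 (volume.restrict (Set.Ioo 0 S)))
      (w : Lp V 2 (volume.restrict (Set.Ioo 0 S))),
      (P.B.compLp u - P.a.compLp w : Lp (StrongDual ℝ V) 2 (volume.restrict (Set.Ioo 0 S)))
        =ᵐ[volume.restrict (Set.Ioo 0 S)] fun t ↦ P.B (u t) - P.a (w t) := fun u w ↦ by
    filter_upwards [Lp.coeFn_sub (P.B.compLp u) (P.a.compLp w), P.B.coeFn_compLp u,
      P.a.coeFn_compLp w] with t e1 e2 e3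
    rw [e1, Pi.sub_apply, e2, e3]
  have hFlim : Tendsto F atTop (𝓝 D) :=
    (((P.B.compLpL 2 (volume.restrict (Set.Ioo 0 S))).continuous.tendsto _).comp hUlim).sub
      (((P.a.compLpL 2 (volume.restrict (Set.Ioo 0 S))).continuous.tendsto _).comp hWlim)
  have hDlim : Tendsto (fun n ↦ (hW n).memLp_dy.toLp (dy n)) atTop (𝓝 D) := by
    have h1 : Tendsto (fun n ↦ (hW n).memLp_dy.toLp (dy n) - F n) atTop (𝓝 0) := by
      refine squeeze_zero_norm (fun n ↦ ?_) hεlim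
      rw [Lp.norm_def]
      refine ENNReal.toReal_le_of_le_ofReal (hεpos n).le ?_
      refine le_of_eq_of_le (eLpNorm_congr_ae ?_) (hres n)
      filter_upwards [Lp.coeFn_sub ((hW n).memLp_dy.toLp (dy n)) (F n),
        (hW n).memLp_dy.coeFn_toLp, hcoe (x n).fst (x n).snd] with t e1 e2 e3
      rw [e1, Pi.sub_apply, e2, e3]
    have h2 := h1.add hFlim
    simpa using h2
  obtain ⟨z, hz, hzlim⟩ := P.exists_isW_of_tendsto hS hW hy0 (W := x'.snd) (D := D)
    (by simpa using hWlim) hDlim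
  refine ⟨_, ⟨x'.fst, z, ⟨Lp.memLp _, ?_⟩, ⟨?_, x'.snd, D, hz, ?_⟩, rfl⟩, ?_⟩
  · obtain ⟨ns, _, hns⟩ := (tendstoInMeasure_of_tendsto_Lp hUlim).exists_seq_tendsto_ae
    filter_upwards [hns, ae_all_iff.2 hU] with t h1 h2
    exact P.isClosed_Uad.mem_of_tendsto h1 (.of_forall fun n ↦ h2 _)
  · refine tendsto_nhds_unique (hzlim 0 ⟨le_rfl, hS⟩) ?_
    simp only [hy0]
    exact tendsto_const_nhds
  · filter_upwards [hcoe x'.fst x'.snd] with t e1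
    rw [hDdef, e1]
    simp
  · have h1 : Tendsto (fun n ↦ ‖y n S - P.yd‖) atTop (𝓝 ‖z S - P.yd‖) :=
      ((hzlim S ⟨hS, le_rfl⟩).sub_const _).norm
    have h2 : Tendsto (fun n ↦ r + ε n) atTop (𝓝 (r + 0)) := hεlim.const_add r
    rw [add_zero] at h2
    exact le_of_tendsto_of_tendsto' h1 h2 hd

/-- Dilating a state `y` from `(0,T)` to `(0,S)` produces `t ↦ y(T t / S)`, with residual
`(T / S - 1) y'(T t / S)`. -/
theorem approxSet_nonempty (P : ParabolicControlProblem V H ϱ)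
    (hbounded : Bornology.IsBounded P.Uad) {S r : ℝ} (hS : 0 < S)
    (h : ∀ ε : ℝ, 0 < ε → ∃ T : ℝ, 0 < T ∧ |T - S| < ε ∧ ∃ d ∈ P.distances T, d ≤ r + ε) :
    ∃ R : ℝ, ∀ ε : ℝ, 0 < ε → (P.approxSet S r R ε).Nonempty := by
  obtain ⟨C, hC0, hC⟩ := P.exists_eLpNorm_le hbounded (S + 1)
  refine ⟨4 * C, fun ε hε ↦ ?_⟩
  obtain ⟨T, hT, hTS, d, ⟨u, y, hu, ⟨hy0, w, dy, hW, heq⟩, rfl⟩, hd⟩ :=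
    -- `1` keeps `T ≤ S + 1` for the a priori bound, `S / 2` keeps `S ≤ 4 T`, and the last entry
    -- makes the residual, of norm at most `|T / S - 1| * (2 * C)`, at most `ε`
    h (min (min 1 (S / 2)) (min ε (ε * S / (2 * C + 1)))) (by positivity)
  have hT1 : |T - S| < 1 := hTS.trans_le ((min_le_left _ _).trans (min_le_left _ _))
  have hT2 : |T - S| < S / 2 := hTS.trans_le ((min_le_left _ _).trans (min_le_right _ _))
  have hT4 : |T - S| < ε * S / (2 * C + 1) :=
    hTS.trans_le ((min_le_right _ _).trans (min_le_right _ _))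
  have hd' : ‖y T - P.yd‖ ≤ r + ε := hd.trans (by
    gcongr; exact (min_le_right _ _).trans (min_le_left _ _))
  have hTle : S ≤ 4 * T := by linarith [(abs_lt.1 hT2).1]
  obtain ⟨hCu, hCw, hCdy⟩ := hC T hT.le (by linarith [(abs_lt.1 hT1).2]) u y w dy hu hy0 hW heq
  have hmu := memLp_comp_mul_left hS hT hu.1
  have hmw := memLp_comp_mul_left hS hT hW.memLp_w
  have hbu := eLpNorm_comp_mul_left_le hS hT hTle hu.1 hCu
  have hbw := eLpNorm_comp_mul_left_le hS hT hTle hW.memLp_w hCw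
  have hbdy := eLpNorm_comp_mul_left_le hS hT hTle hW.memLp_dy hCdy
  refine ⟨WithLp.toLp 2 (hmu.toLp _, hmw.toLp _), ?_, ?_, fun t ↦ y (T / S * t),
    fun t ↦ (T / S) • dy (T / S * t), by simp [hy0],
    (hW.comp_mul_left hS hT).congr hmw.coeFn_toLp.symm EventuallyEq.rfl, ?_, ?_⟩
  · have h1 : ‖hmu.toLp _‖ ≤ 2 * C := by
      rw [Lp.norm_toLp]; exact ENNReal.toReal_le_of_le_ofReal (by positivity) hbu
    have h2 : ‖hmw.toLp _‖ ≤ 2 * C := by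
      rw [Lp.norm_toLp]; exact ENNReal.toReal_le_of_le_ofReal (by positivity) hbw
    refine le_of_sq_le_sq ?_ (by positivity)
    rw [WithLp.prod_norm_sq_eq_of_L2]
    have h3 := pow_le_pow_left₀ (norm_nonneg _) h1 2
    have h4 := pow_le_pow_left₀ (norm_nonneg _) h2 2
    simp only [WithLp.toLp_fst, WithLp.toLp_snd]
    nlinarith
  · filter_upwards [hmu.coeFn_toLp, ae_comp_mul_left hS hT hu.2] with t e1 e2
    simpa only [WithLp.toLp_fst, e1] using e2
  · have e : (fun t ↦ (T / S) • dy (T / S * t) - (P.B (hmu.toLp _ t) - P.a (hmw.toLp _ t)))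
        =ᵐ[volume.restrict (Set.Ioo 0 S)] fun t ↦ (T / S - 1) • dy (T / S * t) := by
      filter_upwards [hmu.coeFn_toLp, hmw.coeFn_toLp, ae_comp_mul_left hS hT heq] with t e1 e2 e3
      rw [e1, e2, ← e3]
      ext v
      simp
      ring
    refine (eLpNorm_congr_ae e).trans_le ?_
    have hsmul : ∀ t : ℝ, ‖(T / S - 1) • dy (T / S * t)‖ ≤ |T / S - 1| * ‖dy (T / S * t)‖ :=
      fun t ↦ norm_smul_le (T / S - 1) (dy (T / S * t))
    refine (eLpNorm_le_mul_eLpNorm_of_ae_le_mul (.of_forall hsmul) 2).trans ?_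
    refine (mul_le_mul_right hbdy _).trans ?_
    rw [← ENNReal.ofReal_mul (abs_nonneg _)]
    refine ENNReal.ofReal_le_ofReal ?_
    have e1 : T / S - 1 = (T - S) / S := by field_simp
    rw [e1, abs_div, abs_of_pos hS, div_mul_eq_mul_div, div_le_iff₀ hS]
    rw [lt_div_iff₀ (by positivity)] at hT4
    nlinarith [abs_nonneg (T - S)]
  · have e : T / S * S = T := by field_simp
    simpa only [e] using hd'

/-! ### Closedness of the attainable distances in time -/

theorem norm_intervalIntegral_le {E : Type*} [NormedAddCommGroup E] [NormedSpace ℝ E]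
    {f : ℝ → E} {T C : ℝ} (hT : 0 ≤ T) (hC : 0 ≤ C)
    (hf : MemLp f 2 (volume.restrict (Set.Ioo 0 T)))
    (h : eLpNorm f 2 (volume.restrict (Set.Ioo 0 T)) ≤ ENNReal.ofReal C) :
    ‖∫ t in (0 : ℝ)..T, f t‖ ≤ C * Real.sqrt T := by
  rw [intervalIntegral.integral_of_le hT, integral_Ioc_eq_integral_Ioo]
  refine (norm_integral_le_integral_norm _).trans ?_
  rw [integral_norm_eq_lintegral_enorm hf.1, ← eLpNorm_one_eq_lintegral_enorm]
  refine ENNReal.toReal_le_of_le_ofReal (by positivity) ?_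
  refine (eLpNorm_le_eLpNorm_mul_rpow_measure_univ (q := 2) (by norm_num) hf.1).trans ?_
  rw [ENNReal.ofReal_mul hC]
  refine mul_le_mul' h (le_of_eq ?_)
  rw [Measure.restrict_apply_univ, Real.volume_Ioo, sub_zero,
    ENNReal.ofReal_rpow_of_nonneg hT (by norm_num), Real.sqrt_eq_rpow]
  norm_num

/-- States at small times are close to `y₀` in `V*`, uniformly in the control, and `ι` has dense
range; this suffices for the lower semicontinuity of the norm. -/
theorem norm_initial_le (P : ParabolicControlProblem V H ϱ)
    (hbounded : Bornology.IsBounded P.Uad) {r : ℝ}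
    (h : ∀ ε : ℝ, 0 < ε → ∃ T : ℝ, 0 < T ∧ T < ε ∧ ∃ d ∈ P.distances T, d ≤ r + ε) :
    ‖P.y₀ - P.yd‖ ≤ r := by
  have hr : 0 ≤ r := le_of_forall_pos_le_add fun ε hε ↦ by
    obtain ⟨T, _, _, d, ⟨u, y, _, _, rfl⟩, hd⟩ := h ε hε
    exact (norm_nonneg _).trans hd
  obtain ⟨C, hC0, hC⟩ := P.exists_eLpNorm_le hbounded 1
  have hV : ∀ v : V, inner ℝ (P.y₀ - P.yd) (P.ι v) ≤ r * ‖P.ι v‖ := by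
    intro v
    have hlim : Tendsto (fun ε : ℝ ↦ (r + ε) * ‖P.ι v‖ + C * Real.sqrt ε * ‖v‖) (𝓝[>] 0)
        (𝓝 ((r + 0) * ‖P.ι v‖ + C * Real.sqrt 0 * ‖v‖)) :=
      (Continuous.tendsto (by fun_prop) 0).mono_left nhdsWithin_le_nhds
    simp only [add_zero, Real.sqrt_zero, mul_zero, zero_mul] at hlim
    refine ge_of_tendsto hlim ?_
    have hev : ∀ᶠ ε : ℝ in 𝓝[>] 0, ε ∈ Set.Ioo (0 : ℝ) 1 := Ioo_mem_nhdsGT one_pos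
    filter_upwards [hev] with ε hε
    obtain ⟨T, hT, hTε, d, ⟨u, y, hu, ⟨hy0, w, dy, hW, heq⟩, rfl⟩, hd⟩ := h ε hε.1
    obtain ⟨-, -, hCdy⟩ := hC T hT.le (hTε.le.trans hε.2.le) u y w dy hu hy0 hW heq
    have h1 := norm_intervalIntegral_le hT.le hC0 hW.memLp_dy hCdy
    have h2 := hW.primitive T ⟨hT.le, le_rfl⟩
    rw [hy0] at h2
    have h3 : inner ℝ (P.y₀ - P.yd) (P.ι v)
        = inner ℝ (y T - P.yd) (P.ι v) - (∫ s in (0 : ℝ)..T, dy s) v := by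
      have := congrArg (fun g : StrongDual ℝ V ↦ g v) h2
      simp only [toDual_apply, add_apply] at this
      simp only [inner_sub_left]
      linarith
    have h4 : -(∫ s in (0 : ℝ)..T, dy s) v ≤ C * Real.sqrt ε * ‖v‖ :=
      calc -(∫ s in (0 : ℝ)..T, dy s) v ≤ ‖(∫ s in (0 : ℝ)..T, dy s) v‖ := neg_le_abs _
        _ ≤ ‖∫ s in (0 : ℝ)..T, dy s‖ * ‖v‖ := ContinuousLinearMap.le_opNorm _ _
        _ ≤ C * Real.sqrt T * ‖v‖ := by gcongr
        _ ≤ C * Real.sqrt ε * ‖v‖ := by gcongr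
    have h5 : inner ℝ (y T - P.yd) (P.ι v) ≤ (r + ε) * ‖P.ι v‖ :=
      (real_inner_le_norm _ _).trans (by gcongr)
    linarith
  have hH : ∀ x : H, inner ℝ (P.y₀ - P.yd) x ≤ r * ‖x‖ := fun x ↦
    P.ι_dense.induction_on (p := fun x ↦ inner ℝ (P.y₀ - P.yd) x ≤ r * ‖x‖) x
      (isClosed_le (by fun_prop) (by fun_prop)) hV
  have h1 := hH (P.y₀ - P.yd)
  rw [real_inner_self_eq_norm_sq] at h1
  by_contra! hlt
  nlinarith

/-- On the empty interval `(0,0)` the only requirement on a state is its initial value. -/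
theorem distances_zero (P : ParabolicControlProblem V H ϱ) :
    P.distances 0 = {‖P.y₀ - P.yd‖} := by
  ext d
  constructor
  · rintro ⟨u, y, _, ⟨h0, _⟩, rfl⟩
    rw [h0]; rfl
  · rintro rfl
    refine ⟨0, fun _ ↦ P.y₀, ⟨by simp, by simp⟩, ⟨rfl, 0, 0, ⟨continuousOn_const, by simp, by simp,
      by simp, fun t ht ↦ by simp⟩, by simp⟩, rfl⟩

/-- The attainable distances are closed under limits, also with respect to the final time, which
may be approached from either side. -/
theorem exists_distance_le_of_forall (P : ParabolicControlProblem V H ϱ)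
    (hbounded : Bornology.IsBounded P.Uad) {S r : ℝ} (hS : 0 ≤ S)
    (h : ∀ ε : ℝ, 0 < ε → ∃ T : ℝ, 0 < T ∧ |T - S| < ε ∧ ∃ d ∈ P.distances T, d ≤ r + ε) :
    ∃ d ∈ P.distances S, d ≤ r := by
  rcases hS.eq_or_lt with rfl | hpos
  · refine ⟨_, by rw [distances_zero]; rfl, P.norm_initial_le hbounded fun ε hε ↦ ?_⟩
    obtain ⟨T, hT, hTε, hd⟩ := h ε hε
    rw [sub_zero, abs_of_pos hT] at hTε
    exact ⟨T, hT, hTε, hd⟩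
  · obtain ⟨R, hR⟩ := P.approxSet_nonempty hbounded hpos h
    exact P.exists_distance_le_of_approxSet_nonempty hS hR

/-! ### The value functions -/

theorem minTime_le (P : ParabolicControlProblem V H ϱ) {T d δ : ℝ} (hT : 0 < T)
    (hd : d ∈ P.distances T) (h : d ≤ P.δ₀ + δ) : P.minTime δ ≤ ENNReal.ofReal T :=
  sInf_le ⟨T, hT, ⟨d, hd, h⟩, rfl⟩

theorem exists_of_minTime_lt (P : ParabolicControlProblem V H ϱ) {δ : ℝ} {c : ℝ≥0∞}
    (h : P.minTime δ < c) :
    ∃ T : ℝ, 0 < T ∧ ENNReal.ofReal T < c ∧ ∃ d ∈ P.distances T, d ≤ P.δ₀ + δ := by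
  obtain ⟨_, ⟨T, hT, hd, rfl⟩, hlt⟩ := sInf_lt_iff.1 h
  exact ⟨T, hT, hlt, hd⟩

theorem antitone_minTime (P : ParabolicControlProblem V H ϱ) : Antitone P.minTime := by
  intro δ δ' h
  refine sInf_le_sInf ?_
  rintro _ ⟨T, hT, ⟨d, hd, hle⟩, rfl⟩
  exact ⟨T, hT, ⟨d, hd, by linarith⟩, rfl⟩

theorem exists_distance_minTime_le (P : ParabolicControlProblem V H ϱ)
    (hbounded : Bornology.IsBounded P.Uad) {δ : ℝ} (hfin : P.minTime δ ≠ ∞) :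
    ∃ d ∈ P.distances (P.minTime δ).toReal, d ≤ P.δ₀ + δ := by
  refine P.exists_distance_le_of_forall hbounded ENNReal.toReal_nonneg fun ε hε ↦ ?_
  have hlt : P.minTime δ < ENNReal.ofReal ((P.minTime δ).toReal + ε) := by
    rw [ENNReal.lt_ofReal_iff_toReal_lt hfin]
    linarith
  obtain ⟨T, hT, hTlt, d, hd, hle⟩ := P.exists_of_minTime_lt hlt
  have h1 : (P.minTime δ).toReal ≤ T :=
    ENNReal.toReal_le_of_le_ofReal hT.le (P.minTime_le hT hd hle)
  have h2 : T < (P.minTime δ).toReal + ε := (ENNReal.ofReal_lt_ofReal_iff_of_nonneg hT.le).1 hTlt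
  exact ⟨T, hT, abs_lt.2 ⟨by linarith, by linarith⟩, d, hd, by linarith⟩

/-- Right-continuity of the antitone function `minTime`. The assumption `minTime δ• = 0` covers
the case in which the times `minTime (δ + ε)` all vanish, since `minTime δ` is an infimum over
positive times. -/
theorem minTime_le_of_forall_add (P : ParabolicControlProblem V H ϱ)
    (hbounded : Bornology.IsBounded P.Uad) (hend : P.minTime P.deltaBullet = 0) {δ : ℝ}
    {c : ℝ≥0∞} (hc : c ≠ ∞) (h : ∀ ε : ℝ, 0 < ε → P.minTime (δ + ε) ≤ c) :
    P.minTime δ ≤ c := by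
  set s : ℝ≥0∞ := ⨆ ε : {ε : ℝ // 0 < ε}, P.minTime (δ + ε) with hs
  have hsc : s ≤ c := iSup_le fun ε ↦ h ε ε.2
  have hsfin : s ≠ ∞ := ne_top_of_le_ne_top hc hsc
  have hle : ∀ ε : ℝ, 0 < ε → P.minTime (δ + ε) ≤ s := fun ε hε ↦
    le_iSup (fun ε : {ε : ℝ // 0 < ε} ↦ P.minTime (δ + ε)) ⟨ε, hε⟩
  refine le_trans ?_ hsc
  obtain ⟨d, hd, hdle⟩ := P.exists_distance_le_of_forall (r := P.δ₀ + δ) hbounded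
    (S := s.toReal) ENNReal.toReal_nonneg fun ε hε ↦ by
    -- by definition of `s` as a supremum, times near `s` are needed for small `ε₁`
    have h1 : ∃ ε₁ : ℝ, 0 < ε₁ ∧ ε₁ ≤ ε ∧
        ∀ T : ℝ, 0 < T → P.minTime (δ + ε₁) ≤ ENNReal.ofReal T → s.toReal - ε < T := by
      rcases lt_or_ge (s.toReal - ε) 0 with hneg | hpos
      · exact ⟨ε, hε, le_rfl, fun T hT _ ↦ hneg.trans hT⟩
      · have hlt : ENNReal.ofReal (s.toReal - ε) < s := by
          rw [ENNReal.ofReal_lt_iff_lt_toReal hpos hsfin]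
          linarith
        obtain ⟨⟨ε₁, hε₁0⟩, hε₁⟩ := lt_iSup_iff.1 hlt
        refine ⟨min ε₁ ε, lt_min hε₁0 hε, min_le_right _ _, fun T hT hTle ↦ ?_⟩
        have h2 : P.minTime (δ + ε₁) ≤ P.minTime (δ + min ε₁ ε) :=
          P.antitone_minTime (by gcongr; exact min_le_left _ _)
        exact (ENNReal.ofReal_lt_ofReal_iff hT).1 ((hε₁.trans_le h2).trans_le hTle)
    obtain ⟨ε₁, hε₁, hε₁ε, hlow⟩ := h1
    have hlt : P.minTime (δ + ε₁) < ENNReal.ofReal (s.toReal + ε) := by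
      refine (hle ε₁ hε₁).trans_lt ?_
      rw [ENNReal.lt_ofReal_iff_toReal_lt hsfin]
      linarith
    obtain ⟨T, hT, hTlt, d, hd, hdle⟩ := P.exists_of_minTime_lt hlt
    have h2 := (ENNReal.ofReal_lt_ofReal_iff_of_nonneg hT.le).1 hTlt
    have h3 := hlow T hT (P.minTime_le hT hd hdle)
    exact ⟨T, hT, abs_lt.2 ⟨by linarith, by linarith⟩, d, hd, by linarith⟩
  rcases (ENNReal.toReal_nonneg : 0 ≤ s.toReal).eq_or_lt with h0 | hpos
  · rw [← h0, distances_zero, Set.mem_singleton_iff] at hd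
    have h1 : P.minTime δ ≤ P.minTime P.deltaBullet := P.antitone_minTime (by
      unfold deltaBullet; linarith)
    rw [hend] at h1
    exact h1.trans zero_le
  · exact (P.minTime_le hpos hd hdle).trans_eq (ENNReal.ofReal_toReal hsfin)

/-- A strictly smaller distance would, by continuity of the state, admit an earlier time. -/
theorem le_distance_of_mem (P : ParabolicControlProblem V H ϱ) {δ : ℝ}
    (hδ : δ ≤ P.deltaBullet) {d : ℝ}
    (hd : d ∈ P.distances (P.minTime δ).toReal) : P.δ₀ + δ ≤ d := by
  rcases (ENNReal.toReal_nonneg : 0 ≤ (P.minTime δ).toReal).eq_or_lt with h0 | hpos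
  · rw [← h0, distances_zero, Set.mem_singleton_iff] at hd
    rw [hd]
    unfold deltaBullet at hδ
    linarith
  · by_contra! hlt
    obtain ⟨u, y, hu, hy, rfl⟩ := hd
    set T := (P.minTime δ).toReal with hT
    have hcont : ContinuousWithinAt (fun t ↦ ‖y t - P.yd‖) (Set.Icc 0 T) T := by
      obtain ⟨_, w, dy, hW, _⟩ := hy
      exact ((hW.continuousOn T ⟨hpos.le, le_rfl⟩).sub continuousWithinAt_const).norm
    have h1 : ∀ᶠ t in 𝓝[<] T, ‖y t - P.yd‖ < P.δ₀ + δ := by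
      have h2 : Tendsto (fun t ↦ ‖y t - P.yd‖) (𝓝[<] T) (𝓝 ‖y T - P.yd‖) := by
        rw [← nhdsWithin_Ioo_eq_nhdsLT hpos]
        exact hcont.mono Set.Ioo_subset_Icc_self
      exact h2.eventually_lt_const hlt
    obtain ⟨t, ht, htI⟩ := (h1.and (Ioo_mem_nhdsLT hpos)).exists
    have h3 : P.minTime δ ≤ ENNReal.ofReal t :=
      P.minTime_le htI.1 ⟨u, y, hu.restrict htI.2.le, hy.restrict htI.2.le, rfl⟩ ht.le
    exact absurd (ENNReal.toReal_le_of_le_ofReal htI.1.le h3) (not_le.2 htI.2)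

theorem minDist_minTime (P : ParabolicControlProblem V H ϱ)
    (hbounded : Bornology.IsBounded P.Uad) {δ : ℝ} (hδ : δ ≤ P.deltaBullet)
    (hfin : P.minTime δ ≠ ∞) : P.minDist (P.minTime δ).toReal = δ := by
  refine IsLeast.csInf_eq ⟨?_, ?_⟩
  · obtain ⟨d, hd, hle⟩ := P.exists_distance_minTime_le hbounded hfin
    exact ⟨d, hd, by linarith [P.le_distance_of_mem hδ hd]⟩
  · rintro _ ⟨d, hd, rfl⟩
    linarith [P.le_distance_of_mem hδ hd]

/-- The intermediate value property of `minTime`; the preimage is the least `δ ≥ 0` with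
`minTime δ ≤ T`. -/
theorem exists_minTime_eq (P : ParabolicControlProblem V H ϱ)
    (hbounded : Bornology.IsBounded P.Uad)
    (hnonneg : 0 ≤ P.deltaBullet)
    (hleft : ∀ δ : ℝ, 0 < δ → ContinuousWithinAt P.minTime (Set.Iic δ) δ)
    (hend : P.minTime P.deltaBullet = 0) {T : ℝ} (hT : T ∈ P.timeInterval) :
    ∃ δ ∈ Set.Icc 0 P.deltaBullet, P.minTime δ = ENNReal.ofReal T := by
  set A : Set ℝ := {δ | 0 ≤ δ ∧ P.minTime δ ≤ ENNReal.ofReal T} with hA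
  have hmem : P.deltaBullet ∈ A := ⟨hnonneg, by rw [hend]; exact zero_le⟩
  have hbdd : BddBelow A := ⟨0, fun δ h ↦ h.1⟩
  have h0 : 0 ≤ sInf A := le_csInf ⟨_, hmem⟩ fun δ h ↦ h.1
  refine ⟨sInf A, ⟨h0, csInf_le hbdd hmem⟩, le_antisymm ?_ ?_⟩
  · refine P.minTime_le_of_forall_add hbounded hend ENNReal.ofReal_ne_top fun ε hε ↦ ?_
    obtain ⟨a, ha, hlt⟩ := exists_lt_of_csInf_lt ⟨_, hmem⟩ (lt_add_of_pos_right (sInf A) hε)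
    exact (P.antitone_minTime hlt.le).trans ha.2
  · rcases h0.eq_or_lt with h0 | hpos
    · rw [← h0]; exact hT.2
    · have h1 : Tendsto P.minTime (𝓝[<] sInf A) (𝓝 (P.minTime (sInf A))) :=
        (hleft _ hpos).mono_left (nhdsWithin_mono _ Set.Iio_subset_Iic_self)
      refine ge_of_tendsto h1 ?_
      filter_upwards [Ioo_mem_nhdsLT hpos] with δ hδ
      by_contra! hlt
      exact absurd (csInf_le hbdd ⟨hδ.1.le, hlt.le⟩) (not_le.2 hδ.2)

theorem continuousOn_of_strictAntiOn_of_surjOn_Icc {f : ℝ → ℝ} {s : Set ℝ} {a b : ℝ}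
    [s.OrdConnected] (hf : StrictAntiOn f s) (hmaps : Set.MapsTo f s (Set.Icc a b))
    (hsurj : Set.SurjOn f s (Set.Icc a b)) : ContinuousOn f s := by
  -- as a monotone surjection onto the order dual of `[a, b]`
  have hmono : Monotone fun x : s ↦ OrderDual.toDual (⟨f x, hmaps x.2⟩ : Set.Icc a b) :=
    fun x x' h ↦ hf.antitoneOn x.2 x'.2 h
  have hs : Function.Surjective
      fun x : s ↦ OrderDual.toDual (⟨f x, hmaps x.2⟩ : Set.Icc a b) := fun z ↦ by
    obtain ⟨x, hx, he⟩ := hsurj (OrderDual.ofDual z).2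
    exact ⟨⟨x, hx⟩, congrArg OrderDual.toDual (Subtype.ext he)⟩
  have hc := hmono.continuous_of_surjective hs
  rw [continuousOn_iff_continuous_domRestrict]
  exact continuous_subtype_val.comp (continuous_ofDual.comp hc)

end ParabolicControlProblem

theorem mainTheorem2 {V H : Type*}
    [NormedAddCommGroup V] [InnerProductSpace ℝ V] [CompleteSpace V]
    [NormedAddCommGroup H] [InnerProductSpace ℝ H] [CompleteSpace H]
    {Ω : Type*} [MeasurableSpace Ω] {ϱ : Measure Ω}
    (P : ParabolicControlProblem V H ϱ)
    (hbounded : Bornology.IsBounded P.Uad)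
    (hfeasible : ∃ T : ℝ, 0 < T ∧ ∃ d ∈ P.distances T, d ≤ P.δ₀)
    (hnontrivial : P.δ₀ < ‖P.y₀ - P.yd‖)
    (hleft : ∀ δ : ℝ, 0 < δ → ContinuousWithinAt P.minTime (Set.Iic δ) δ)
    (hend : P.minTime P.deltaBullet = 0) :
    Set.MapsTo P.minDist P.timeInterval (Set.Ici 0) ∧
    ContinuousOn P.minDist P.timeInterval ∧
    StrictAntiOn P.minDist P.timeInterval ∧
    (∀ T' ∈ P.timeInterval, P.minTime (P.minDist T') = ENNReal.ofReal T') ∧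
    (∀ δ' ∈ Set.Icc 0 P.deltaBullet,
      P.minTime δ' ≠ ∞ ∧ P.minDist (P.minTime δ').toReal = δ') := by
  have hbullet : 0 ≤ P.deltaBullet := by
    unfold ParabolicControlProblem.deltaBullet
    linarith
  have hfin : ∀ δ : ℝ, 0 ≤ δ → P.minTime δ ≠ ∞ := fun δ hδ ↦ by
    obtain ⟨T, hT, d, hd, hle⟩ := hfeasible
    exact ne_top_of_le_ne_top ENNReal.ofReal_ne_top (P.minTime_le hT hd (by linarith))
  have hDT : ∀ δ ∈ Set.Icc 0 P.deltaBullet, P.minDist (P.minTime δ).toReal = δ := fun δ hδ ↦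
    P.minDist_minTime hbounded hδ.2 (hfin δ hδ.1)
  have hTD : ∀ T ∈ P.timeInterval, P.minDist T ∈ Set.Icc 0 P.deltaBullet ∧
      P.minTime (P.minDist T) = ENNReal.ofReal T := fun T hT ↦ by
    obtain ⟨δ, hδ, he⟩ := P.exists_minTime_eq hbounded hbullet hleft hend hT
    have h1 : P.minDist T = δ := by
      have := hDT δ hδ
      rwa [he, ENNReal.toReal_ofReal hT.1] at this
    rw [h1]
    exact ⟨hδ, he⟩
  have hanti : StrictAntiOn P.minDist P.timeInterval := fun S hS T hT hlt ↦ by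
    by_contra! hle
    have h1 := P.antitone_minTime hle
    rw [(hTD S hS).2, (hTD T hT).2, ENNReal.ofReal_le_ofReal_iff hS.1] at h1
    exact absurd hlt (not_lt.2 h1)
  have hord : P.timeInterval.OrdConnected := ⟨fun S hS T hT R hR ↦
    ⟨hS.1.trans hR.1, (ENNReal.ofReal_le_ofReal hR.2).trans hT.2⟩⟩
  refine ⟨fun T hT ↦ (hTD T hT).1.1, ?_, hanti, fun T hT ↦ (hTD T hT).2,
    fun δ hδ ↦ ⟨hfin δ hδ.1, hDT δ hδ⟩⟩
  refine ParabolicControlProblem.continuousOn_of_strictAntiOn_of_surjOn_Icc hanti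
    (fun T hT ↦ (hTD T hT).1) fun δ hδ ↦ ⟨(P.minTime δ).toReal, ⟨ENNReal.toReal_nonneg, ?_⟩,
      hDT δ hδ⟩
  rw [ENNReal.ofReal_toReal (hfin δ hδ.1)]
  exact P.antitone_minTime hδ.1
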